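/- **Setting.** Let $I=[0,1]$. A $\Box$-set $X$ consists of sets $X_n$ ($n\ge 0$) of $n$-cubes and face maps $d_i^{\alpha}:X_n\to X_{n-1}$ ($\alpha\in\{0,1\}$, $1\le i\le n$) with $d_i^{\alpha}d_j^{\beta}=d_{j-1}^{\beta}d_i^{\alpha}$ for $i<j$. Its realization is $|X|=\bigsqcup_n X_n\times I^n/\!\sim$, where $[d_i^{\alpha}c,x]\sim[c,\delta_i^{\alpha}x]$ and $\delta_i^\alpha$ inserts $\alpha$ as $i$-th coordinate. The source and the target vertex of a cube are its iterated faces $d_1^0\cdots d_1^0c$ and $d_1^1\cdots d_1^1c$. A partition $J=[J_0|J_*|J_1]$ of $\{1,\dots,n\}$ determines the iterated face $d_Jc$ of an $n$-cube $c$, in which the coordinates in $J_0$ are fixed to be $0$ and those in $J_1$ to be $1$; the collar of the corresponding face of $I^n$ is $C_J=[0,\tfrac12)^{J_0}\times I^{J_*}\times(\tfrac12,1]^{J_1}$. The collar $C(d,X)\subset|X|$ of a cube $d$ is the union of all $[c;C_J]$ for which $d_Jc$ is an iterated face of $d$ (or $d$ itself); the star $st(v)$ of a vertex is $C(v,X)$.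 **Paths.** A path $p:I\to|X|$ is a *d-path* if it has a presentation: there are $0=t_0\le\dots\le t_l=1$, cubes $c_i$ and continuous paths $\beta_i:[t_{i-1},t_i]\to I^{\dim c_i}$ with non-decreasing coordinates such that $p(t)=[c_i;\beta_i(t)]$ on $[t_{i-1},t_i]$. It is *strict* if there is a presentation for which, moreover, every coordinate $\beta$ of every $\beta_i$ satisfies: $\beta(t)=\beta(t')$ implies $t=t'$ or $\beta(t)\in\{0,1\}$. It is *tame* if there is a presentation for which all $p(t_i)$ are vertices. A *cube chain* from $x^-$ to $x^+$ is a sequence $\mathbf c=(c_1,\dots,c_n)$, $n\ge1$, of cubes of positive dimension and vertices $x^-=x_0,x_1,\dots,x_n=x^+$ such that $c_i$ has source $x_{i-1}$ and target $x_i$. A d-path $p$ is *subordinate to $\mathbf c$* if there are $0=t_0\le\dots\le t_n=1$ such that on each $[t_{i-1},t_i]$ one has $p=[c_i;\beta_i]$ with $\beta_i$ non-decreasing from $(0,\dots,0)$ to $(1,\dots,1)$. It is *subordinate to the collar of $\mathbf c$* if there are $0=t_0\le\dots\le t_n=1$ such that $p(t_i)\in st(x_i)$ for all $i$ and, for $1\le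 i\le n$, $p$ runs on $[t_{i-1},t_i]$ in $C(c_i,X)$ from the bottom to the top corner of $c_i$, in the following sense. There are a presentation of $p|_{[t_{i-1},t_i]}$ by pieces $[u_k;\beta_k]$ and partitions $J^k$ and $K^k$ with $d_{J^k}u_k=d_{K^k}c_i$ such that $\beta_k$ stays in $C_{J^k}$. Let $r_k(t)\in I^{\dim c_i}$ be the point of the face of $I^{\dim c_i}$ given by $K^k$ whose free coordinates are the $J^k_*$-coordinates of $\beta_k(t)$. Then, at the time separating the pieces $k$ and $k+1$, each coordinate of $r_k$ and the same coordinate of $r_{k+1}$ are both $<\tfrac12$, both $=\tfrac12$ or both $>\tfrac12$; all coordinates of the first $r_k$ are $<\tfrac12$ at time $t_{i-1}$, and all coordinates of the last $r_k$ are $>\tfrac12$ at time $t_i$. Let $\vec{ST}_{\mathbf c}(X)_{x^-}^{x^+}$ be the space of strict d-paths from $x^-$ to $x^+$ subordinate to $\mathbf c$ (they are tame), and let $\vec S^C_{\mathbf c}(X)_{x^-}^{x^+}$ and $\vec{ST}^C_{\mathbf c}(X)_{x^-}^{x^+}$ be the spaces of strict, respectively of strict and tame, d-paths from $x^-$ to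 $x^+$ subordinate to the collar of $\mathbf c$; all of them are subspaces of $|X|^I$ with the compact-open topology. **Proposition.** For every $\Box$-set $X$, all vertices $x^-,x^+$ and every cube chain $\mathbf c$ in $X$ from $x^-$ to $x^+$: 1. $\vec{ST}_{\mathbf c}(X)_{x^-}^{x^+}\subseteq\vec{S}^C_{\mathbf c}(X)_{x^-}^{x^+}$ is a deformation retract; 2. $\vec{ST}_{\mathbf c}(X)_{x^-}^{x^+}\subseteq\vec{ST}^C_{\mathbf c}(X)_{x^-}^{x^+}$ is a deformation retract. Here $A\subseteq B$ is a deformation retract if there are a continuous $\rho:B\to A$ and a homotopy in $B$ from $\mathrm{id}_B$ to $\rho$ that fixes every point of $A$ at all times. -/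

import Mathlib

open Set unitInterval

universe u

noncomputable section

/-- A `□`-set (pre-cubical set). Coordinates are numbered from `0`; `face false i` and
`face true i` are the lower and the upper `i`-th face maps. -/
structure PrecubicalSet where
  cube : ℕ → Type u
  face : ∀ {n : ℕ}, Bool → Fin (n + 1) → cube (n + 1) → cube n
  face_face : ∀ {n : ℕ} (α β : Bool) (i j : Fin (n + 1)), i ≤ j → ∀ c : cube (n + 2),
    face α i (face β j.succ c) = face β j (face α i.castSucc c)

namespace PrecubicalSet

/-- The end point `0` or `1` of the unit interval. -/
def endpt (α : Bool) : I := if α then 1 else 0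

variable (X : PrecubicalSet.{u})

/-- The source (`α = false`) or the target (`α = true`) vertex of a cube. -/
def corner (α : Bool) : ∀ {n : ℕ}, X.cube n → X.cube 0
  | 0, c => c
  | _ + 1, c => corner α (X.face α 0 c)

/-- The disjoint union of one copy of `Iⁿ` for every `n`-cube. -/
abbrev Cells : Type u := (c : Σ n, X.cube n) × (Fin c.1 → I)

/-- The generating identifications `[d_i^α c, x] ∼ [c, δ_i^α x]`. -/
inductive Glue : X.Cells → X.Cells → Prop
  | glue {n : ℕ} (c : X.cube (n + 1)) (α : Bool) (i : Fin (n + 1)) (x : Fin n → I) :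
      Glue ⟨⟨n, X.face α i c⟩, x⟩ ⟨⟨n + 1, c⟩, i.insertNth (α := fun _ => I) (endpt α) x⟩

/-- The geometric realization, with the quotient topology. -/
def Realization : Type u := Quot X.Glue

instance : TopologicalSpace X.Realization :=
  inferInstanceAs (TopologicalSpace (Quot X.Glue))

variable {X}

/-- The point `[c; x]` of the realization. -/
def pt {n : ℕ} (c : X.cube n) (x : Fin n → I) : X.Realization := Quot.mk _ ⟨⟨n, c⟩, x⟩

/-- A vertex as a point of the realization. -/
def vpt (v : X.cube 0) : X.Realization := pt v Fin.elim0

/-! ### Directed paths -/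

/-- `β` restricts to a (continuous) increasing path `[a,b] → Iⁿ`. -/
def Increasing {n : ℕ} (β : I → Fin n → I) (a b : I) : Prop :=
  ContinuousOn β (Icc a b) ∧ MonotoneOn β (Icc a b)

/-- `β` restricts to a strictly increasing path `[a,b] → Iⁿ`: every coordinate may only pause
at `0` and at `1`. -/
def StrictlyIncreasing {n : ℕ} (β : I → Fin n → I) (a b : I) : Prop :=
  Increasing β a b ∧
    ∀ i, ∀ s ∈ Icc a b, ∀ s' ∈ Icc a b, β s i = β s' i → s = s' ∨ β s i = 0 ∨ β s i = 1

/-- `0 = t_0 ≤ t_1 ≤ … ≤ t_l = 1`. -/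
def IsSubdivision {l : ℕ} (t : Fin (l + 1) → I) : Prop :=
  Monotone t ∧ t 0 = 0 ∧ t (Fin.last l) = 1

/-- On `[a,b]` the path `p` is `[c; β]`. -/
def Presents {n : ℕ} (p : C(I, X.Realization)) (a b : I) (c : X.cube n) (β : I → Fin n → I) :
    Prop :=
  ∀ s ∈ Icc a b, p s = pt c (β s)

/-- `p` is a d-path. -/
def IsDPath (p : C(I, X.Realization)) : Prop :=
  ∃ (l : ℕ) (t : Fin (l + 1) → I), IsSubdivision t ∧ ∀ k : Fin l,
    ∃ (n : ℕ) (c : X.cube n) (β : I → Fin n → I),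
      Increasing β (t k.castSucc) (t k.succ) ∧ Presents p (t k.castSucc) (t k.succ) c β

/-- `p` is a strict d-path. -/
def IsStrict (p : C(I, X.Realization)) : Prop :=
  ∃ (l : ℕ) (t : Fin (l + 1) → I), IsSubdivision t ∧ ∀ k : Fin l,
    ∃ (n : ℕ) (c : X.cube n) (β : I → Fin n → I),
      StrictlyIncreasing β (t k.castSucc) (t k.succ) ∧ Presents p (t k.castSucc) (t k.succ) c β

/-- `p` is a tame d-path. -/
def IsTame (p : C(I, X.Realization)) : Prop :=
  ∃ (l : ℕ) (t : Fin (l + 1) → I), IsSubdivision t ∧ (∀ k, ∃ v : X.cube 0, p (t k) = vpt v) ∧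
    ∀ k : Fin l, ∃ (n : ℕ) (c : X.cube n) (β : I → Fin n → I),
      Increasing β (t k.castSucc) (t k.succ) ∧ Presents p (t k.castSucc) (t k.succ) c β

/-- The space of strict d-paths from `x` to `y`; as a subset of `C(I, |X|)` it carries the
compact-open topology. -/
def strictPaths (x y : X.cube 0) : Set C(I, X.Realization) :=
  {p | p 0 = vpt x ∧ p 1 = vpt y ∧ IsStrict p}

/-- The space of strict tame d-paths from `x` to `y`. -/
def strictTamePaths (x y : X.cube 0) : Set C(I, X.Realization) :=
  {p | p 0 = vpt x ∧ p 1 = vpt y ∧ IsStrict p ∧ IsTame p}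

/-! ### Iterated faces and collars -/

/-- `IsFace e c φ`: the `k`-cube `e` is the iterated face `d_{[J₀|J_*|J₁]} c` of the `n`-cube `c`.
The partition is recorded by `φ : Fin n → Bool ⊕ Fin k`: it takes the value `inl false` on `J₀`,
`inl true` on `J₁`, and it sends the `j`-th element of `J_*` to `inr j`. -/
inductive IsFace : ∀ {k n : ℕ}, X.cube k → X.cube n → (Fin n → Bool ⊕ Fin k) → Prop
  | refl {n : ℕ} (c : X.cube n) : IsFace c c Sum.inr
  | step {k n : ℕ} {e : X.cube k} (c : X.cube (n + 1)) (α : Bool) (i : Fin (n + 1))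
      (φ : Fin n → Bool ⊕ Fin k) (h : IsFace e (X.face α i c) φ) :
      IsFace e c (i.insertNth (α := fun _ => Bool ⊕ Fin k) (Sum.inl α) φ)

/-- The inclusion `I^k → I^n` of the face `{0}^{J₀} × I^{J_*} × {1}^{J₁}` given by `φ`. -/
def faceMap {k n : ℕ} (φ : Fin n → Bool ⊕ Fin k) (z : Fin k → I) : Fin n → I :=
  fun i => Sum.elim endpt z (φ i)

/-- The collar `[0,0.5[^{J₀} × I^{J_*} × ]0.5,1]^{J₁}` of the face of `Iⁿ` given by `φ`. -/
def faceCollar {k n : ℕ} (φ : Fin n → Bool ⊕ Fin k) : Set (Fin n → I) :=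
  {y | ∀ i, (φ i = Sum.inl false → (y i : ℝ) < 1 / 2) ∧ (φ i = Sum.inl true → 1 / 2 < (y i : ℝ))}

/-- The collar `C(d, X)`: the union of the collars in all cubes `c` of those faces of `c` that are
also faces of `d`. -/
def collar {m : ℕ} (d : X.cube m) : Set X.Realization :=
  {x | ∃ (n k : ℕ) (c : X.cube n) (e : X.cube k) (φ : Fin n → Bool ⊕ Fin k)
    (ψ : Fin m → Bool ⊕ Fin k), IsFace e c φ ∧ IsFace e d ψ ∧ ∃ y ∈ faceCollar φ, x = pt c y}

/-- The star of a vertex is its collar. -/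
def star (v : X.cube 0) : Set X.Realization := collar v

/-- `r` is a shadow of `p` in the cube `d` over the time interval `[a,b]`: on `[a,b]` the path has
the form `[c; β]` with `β` an increasing path in the collar of a face `e` of `c` that is identified
with a face of `d`, and `r s ∈ I^m` is the point of that face of `d` whose free coordinates are
those of `β s`. -/
def IsShadow {m : ℕ} (p : C(I, X.Realization)) (d : X.cube m) (a b : I) (r : I → Fin m → I) :
    Prop :=
  ∃ (n k : ℕ) (c : X.cube n) (e : X.cube k) (φ : Fin n → Bool ⊕ Fin k)
    (ψ : Fin m → Bool ⊕ Fin k) (β : I → Fin n → I),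
    IsFace e c φ ∧ IsFace e d ψ ∧ Increasing β a b ∧ Presents p a b c β ∧
    ∀ s ∈ Icc a b, β s ∈ faceCollar φ ∧
      ∃ z : Fin k → I, (∀ i j, φ i = Sum.inr j → β s i = z j) ∧ r s = faceMap ψ z

/-- Two points of `I^m` lie on the same side of (or both on) each middle hyperplane `x_i = 0.5`. -/
def SameSide {m : ℕ} (x y : Fin m → I) : Prop :=
  ∀ i, ((x i : ℝ) < 1 / 2 ↔ (y i : ℝ) < 1 / 2) ∧ (1 / 2 < (x i : ℝ) ↔ 1 / 2 < (y i : ℝ))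

/-- Over `[a,b]` the path `p` runs through the collar of `d` from the star of the source corner to
the star of the target corner, with respect to the coordinates of the cube `d` itself: it has a
presentation with shadows in `I^m` whose positions relative to the middle hyperplanes fit together,
lead from the star of `(0,…,0)` and to the star of `(1,…,1)`.

If distinct faces of `d` may coincide in `X`, this is more than running in `C(d, X)` from the star
of the source to that of the target; for instance, if `d` is a loop, `p` runs through `d` exactly
once. -/
def RunsThrough {m : ℕ} (p : C(I, X.Realization)) (d : X.cube m) (a b : I) : Prop :=
  ∃ (l : ℕ) (s : Fin (l + 2) → I) (r : Fin (l + 1) → I → Fin m → I),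
    Monotone s ∧ s 0 = a ∧ s (Fin.last (l + 1)) = b ∧
    (∀ k, IsShadow p d (s k.castSucc) (s k.succ) (r k)) ∧
    (∀ k : Fin l, SameSide (r k.castSucc (s k.succ.castSucc)) (r k.succ (s k.succ.castSucc))) ∧
    (∀ i, (r 0 a i : ℝ) < 1 / 2) ∧ (∀ i, 1 / 2 < (r (Fin.last l) b i : ℝ))

/-! ### Cube chains -/

variable (X) in
/-- A cube chain `(c_1, …, c_n)` from `x` to `y`, with its vertex sequence `(x_0, …, x_n)`. -/
structure CubeChain (x y : X.cube 0) where
  n : ℕ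
  n_pos : 0 < n
  dim : Fin n → ℕ
  dim_pos : ∀ i, 0 < dim i
  cube : ∀ i, X.cube (dim i)
  vertex : Fin (n + 1) → X.cube 0
  source_eq : ∀ i, X.corner false (cube i) = vertex i.castSucc
  target_eq : ∀ i, X.corner true (cube i) = vertex i.succ
  vertex_zero : vertex 0 = x
  vertex_last : vertex (Fin.last n) = y

namespace CubeChain

variable {x y : X.cube 0} (c : CubeChain X x y)

/-- The (tame) d-paths subordinate to `c`. -/
def tamePathsIn : Set C(I, X.Realization) :=
  {p | ∃ t : Fin (c.n + 1) → I, IsSubdivision t ∧ ∀ i : Fin c.n,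
    ∃ β : I → Fin (c.dim i) → I, Increasing β (t i.castSucc) (t i.succ) ∧
      Presents p (t i.castSucc) (t i.succ) (c.cube i) β ∧
      β (t i.castSucc) = 0 ∧ β (t i.succ) = 1}

/-- The d-paths subordinate to the collar of `c`. -/
def pathsInCollar : Set C(I, X.Realization) :=
  {p | IsDPath p ∧ ∃ t : Fin (c.n + 1) → I, IsSubdivision t ∧
    (∀ i, p (t i) ∈ star (c.vertex i)) ∧
    ∀ i : Fin c.n, (∀ s ∈ Icc (t i.castSucc) (t i.succ), p s ∈ collar (c.cube i)) ∧
      RunsThrough p (c.cube i) (t i.castSucc) (t i.succ)}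

/-- The strict tame d-paths from `x` to `y` subordinate to `c`. -/
def strictTameIn : Set C(I, X.Realization) := c.tamePathsIn ∩ strictPaths x y

/-- The strict d-paths from `x` to `y` subordinate to the collar of `c`. -/
def strictInCollar : Set C(I, X.Realization) := c.pathsInCollar ∩ strictPaths x y

/-- The strict tame d-paths from `x` to `y` subordinate to the collar of `c`. -/
def strictTameInCollar : Set C(I, X.Realization) := c.pathsInCollar ∩ strictTamePaths x y

end CubeChain

end PrecubicalSet

/-- `A ⊆ B` is a deformation retract of `B`: there are a map `ρ : B → A` and a homotopy from the
identity of `B` to `ρ` (followed by the inclusion) that keeps `A` pointwise fixed. -/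
def IsDeformationRetract {Y : Type*} [TopologicalSpace Y] (A B : Set Y) : Prop :=
  ∃ (hAB : A ⊆ B) (ρ : C(B, A)),
    Nonempty (ContinuousMap.HomotopyRel (ContinuousMap.id B)
      ((ContinuousMap.mk (Set.inclusion hAB) (continuous_inclusion hAB)).comp ρ)
      {b : B | (b : Y) ∈ A})

end

/-!
Stretching every coordinate of every cube away from `1/2` by the factor `exp t`, and stopping at `0`
and `1`, is compatible with the face identifications. This gives a semiflow on `|X|` and on its path
space under which all path spaces in question are invariant. It pushes every path in the collar of
`c` into the paths subordinate to `c` in finite time: the coordinates in the collar directions end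
up at `0` or `1`, and agreement of the positions relative to `1/2` makes the pieces fit together.
The retraction follows the flow until the entrance time into `ST_c`.

The entrance time is continuous for two reasons. First, stretching by any positive time maps a whole
neighbourhood of a subordinate path into the subordinate paths, since points near a face are pushed
onto it. Second, the subordinate paths are relatively closed. By compactness, a limit of such paths
still has a monotone lift to the wedge of the cubes of the chain. The number of coordinates equal to
`1/2` is well defined on `|X|` and invariant under the flow, and along a strict path it is nonzero
only finitely often. Counting these crossings, and comparing with the continuous lift of a stretched
path, shows that every coordinate of the lift takes the value `1/2` exactly once. This excludes
jumps of the lift, and its continuity yields subordination.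
-/

open Filter Function Topology
open scoped NNReal

section Flow

variable {Y : Type*} [TopologicalSpace Y] {Φ : Flow ℝ≥0 Y} {A B : Set Y} {p : Y} {t : ℝ≥0}

/-- The time at which the orbit of `p` under the semiflow `Φ` enters `A`; it is `0` if the orbit
avoids `A`. -/
noncomputable def entranceTime (Φ : Flow ℝ≥0 Y) (A : Set Y) (p : Y) : ℝ≥0 :=
  sInf {t | Φ t p ∈ A}

theorem entranceTime_le (h : Φ t p ∈ A) : entranceTime Φ A p ≤ t :=
  csInf_le' h

theorem entranceTime_eq_zero (h : p ∈ A) : entranceTime Φ A p = 0 :=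
  nonpos_iff_eq_zero.1 (entranceTime_le (by rwa [Φ.map_zero_apply]))

theorem flow_mem_of_le (hA : IsInvariant Φ A) {s : ℝ≥0} (hs : Φ s p ∈ A) (hst : s ≤ t) :
    Φ t p ∈ A := by
  rw [← tsub_add_cancel_of_le hst, Φ.map_add]
  exact hA _ hs

theorem flow_entranceTime_mem (hB : IsInvariant Φ B) (hcl : closure A ∩ B ⊆ A) (hp : p ∈ B)
    (h : ∃ t, Φ t p ∈ A) : Φ (entranceTime Φ A p) p ∈ A :=
  hcl ⟨map_mem_closure (f := fun t => Φ t p) (by fun_prop)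
    (csInf_mem_closure h (OrderBot.bddBelow _)) fun _ h => h, hB _ hp⟩

theorem flow_mem_of_entranceTime_le (hA : IsInvariant Φ A) (hB : IsInvariant Φ B)
    (hcl : closure A ∩ B ⊆ A) (hp : p ∈ B) (h : ∃ t, Φ t p ∈ A) (ht : entranceTime Φ A p ≤ t) :
    Φ t p ∈ A :=
  flow_mem_of_le hA (flow_entranceTime_mem hB hcl hp h) ht

theorem continuousOn_entranceTime (hA : IsInvariant Φ A) (hB : IsInvariant Φ B)
    (hcl : closure A ∩ B ⊆ A) (hop : ∀ p ∈ A, ∀ t, 0 < t → ∀ᶠ q in 𝓝[B] p, Φ t q ∈ A)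
    (habs : ∀ p ∈ B, ∃ t, Φ t p ∈ A) : ContinuousOn (entranceTime Φ A) B := by
  intro p hp
  refine tendsto_order.2 ⟨fun t ht => ?_, fun t ht => ?_⟩
  · have hclt : Φ t p ∉ closure A := fun h => (entranceTime_le (hcl ⟨h, hB t hp⟩)).not_gt ht
    have hev : ∀ᶠ q in 𝓝[B] p, Φ t q ∉ closure A := nhdsWithin_le_nhds <|
      (Φ.continuous_toFun t).continuousAt.eventually_mem
        (isClosed_closure.isOpen_compl.mem_nhds hclt)
    filter_upwards [self_mem_nhdsWithin, hev] with q hq hqt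
    by_contra! hle
    exact hqt (subset_closure (flow_mem_of_entranceTime_le hA hB hcl hq (habs q hq) hle))
  · obtain ⟨m, hm, hmt⟩ := exists_between ht
    have hmaps : Tendsto (Φ (entranceTime Φ A p)) (𝓝[B] p) (𝓝[B] Φ (entranceTime Φ A p) p) :=
      (Φ.continuous_toFun _).continuousWithinAt.tendsto_nhdsWithin (hB _)
    filter_upwards [hmaps.eventually (hop _ (flow_entranceTime_mem hB hcl hp (habs p hp))
      (m - entranceTime Φ A p) (tsub_pos_of_lt hm))] with q hq
    rw [← Φ.map_add, tsub_add_cancel_of_le hm.le] at hq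
    exact (entranceTime_le hq).trans_lt hmt

theorem isDeformationRetract_of_flow (hA : IsInvariant Φ A) (hB : IsInvariant Φ B) (hAB : A ⊆ B)
    (hcl : closure A ∩ B ⊆ A) (hop : ∀ p ∈ A, ∀ t, 0 < t → ∀ᶠ q in 𝓝[B] p, Φ t q ∈ A)
    (habs : ∀ p ∈ B, ∃ t, Φ t p ∈ A) : IsDeformationRetract A B := by
  have hcont : Continuous fun p : B => entranceTime Φ A p :=
    continuousOn_iff_continuous_domRestrict.1 (continuousOn_entranceTime hA hB hcl hop habs)
  let ρ : C(B, A) :=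
    ⟨fun p => ⟨_, flow_entranceTime_mem hB hcl p.2 (habs p p.2)⟩,
      (Φ.continuous hcont continuous_subtype_val).subtype_mk _⟩
  refine ⟨hAB, ρ, ⟨{
    toFun := fun q => ⟨Φ (toNNReal q.1 * entranceTime Φ A q.2) q.2, hB _ q.2.2⟩
    continuous_toFun := (Φ.continuous ((toNNReal_continuous.comp continuous_fst).mul
      (hcont.comp continuous_snd)) (continuous_subtype_val.comp continuous_snd)).subtype_mk _
    map_zero_left := fun p => Subtype.ext (by simp)
    map_one_left := fun p => Subtype.ext (by simp [ρ])
    prop' := fun s p hp =>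
      Subtype.ext (by simp [entranceTime_eq_zero (show (p : Y) ∈ A from hp)]) }⟩⟩

/-- The flow on a space of maps induced by a flow on the target. -/
def mapsFlow {τ : Type*} [TopologicalSpace τ] [AddZero τ] (K : Type*) [TopologicalSpace K]
    [LocallyCompactSpace K] (Φ : Flow τ Y) : Flow τ C(K, Y) where
  toFun t f := ⟨fun s => Φ t (f s), by fun_prop⟩
  cont' := ContinuousMap.continuous_of_continuous_uncurry _ (by unfold uncurry; dsimp; fun_prop)
  map_add' s t f := ContinuousMap.ext fun _ => Φ.map_add s t _
  map_zero' f := ContinuousMap.ext fun _ => Φ.map_zero_apply _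

end Flow

section Connected

theorem subset_of_isPreconnected_of_subset_iUnion {α ι : Type*} [TopologicalSpace α] {s : Set α}
    {U : ι → Set α} (hs : IsPreconnected s) (hU : ∀ i, IsOpen (U i))
    (hd : Pairwise (Disjoint on U)) (hsU : s ⊆ ⋃ i, U i) {x : α} {i : ι} (hxs : x ∈ s)
    (hxi : x ∈ U i) : s ⊆ U i := by
  refine hs.subset_left_of_subset_union (hU i) (v := ⋃ (j) (_ : i ≠ j), U j)
    (isOpen_biUnion fun j _ => hU j) ?_ (fun y hy => ?_) ⟨x, hxs, hxi⟩
  · exact disjoint_iUnion₂_right.2 fun j hj => hd hj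
  · obtain ⟨j, hj⟩ := mem_iUnion.1 (hsU hy)
    by_cases hij : i = j
    · exact .inl (hij ▸ hj)
    · exact .inr (mem_iUnion₂.2 ⟨j, hij, hj⟩)

end Connected

namespace PrecubicalSet

section Stretch

variable {s t : ℝ≥0} {x y : I} {ι : Type*}

/-- The expansion of the real line by the factor `exp t` away from `1/2`. -/
noncomputable def dilate (t : ℝ≥0) (x : ℝ) : ℝ := 1 / 2 + Real.exp t * (x - 1 / 2)

theorem continuous_dilate : Continuous fun q : ℝ≥0 × ℝ => dilate q.1 q.2 := by
  unfold dilate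
  fun_prop

theorem dilate_strictMono (t : ℝ≥0) : StrictMono (dilate t) := fun x y h => by
  unfold dilate
  gcongr

theorem dilate_zero (x : ℝ) : dilate 0 x = x := by
  simp [dilate]

theorem dilate_add (s t : ℝ≥0) (x : ℝ) : dilate (s + t) x = dilate s (dilate t x) := by
  simp only [dilate, NNReal.coe_add, Real.exp_add]
  ring

theorem dilate_half (t : ℝ≥0) : dilate t (1 / 2) = 1 / 2 := by
  simp [dilate]

theorem dilate_lt_half_iff {x : ℝ} : dilate t x < 1 / 2 ↔ x < 1 / 2 := by
  simpa only [dilate_half] using (dilate_strictMono t).lt_iff_lt (a := x) (b := 1 / 2)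

theorem half_lt_dilate_iff {x : ℝ} : 1 / 2 < dilate t x ↔ 1 / 2 < x := by
  simpa only [dilate_half] using (dilate_strictMono t).lt_iff_lt (a := 1 / 2) (b := x)

theorem dilate_at_zero_nonpos (t : ℝ≥0) : dilate t 0 ≤ 0 := by
  have := Real.one_le_exp t.coe_nonneg
  unfold dilate
  linarith

theorem one_le_dilate_at_one (t : ℝ≥0) : 1 ≤ dilate t 1 := by
  have := Real.one_le_exp t.coe_nonneg
  unfold dilate
  linarith

theorem tendsto_dilate_atBot {x : ℝ} (h : x < 1 / 2) :
    Tendsto (fun t => dilate t x) atTop atBot :=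
  tendsto_atBot_add_const_left _ _ <| (Real.tendsto_exp_atTop.comp
    (NNReal.tendsto_coe_atTop.2 tendsto_id)).atTop_mul_const_of_neg (by linarith)

theorem tendsto_dilate_atTop {x : ℝ} (h : 1 / 2 < x) :
    Tendsto (fun t => dilate t x) atTop atTop :=
  tendsto_atTop_add_const_left _ _ <| (Real.tendsto_exp_atTop.comp
    (NNReal.tendsto_coe_atTop.2 tendsto_id)).atTop_mul_const (by linarith)

/-- The semiflow on `I` that expands `I` away from its midpoint and stops at the end points. -/
noncomputable def stretch (t : ℝ≥0) (x : I) : I := projIcc 0 1 zero_le_one (dilate t x)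

theorem continuous_stretch : Continuous fun q : ℝ≥0 × I => stretch q.1 q.2 :=
  continuous_projIcc.comp (continuous_dilate.comp
    (continuous_fst.prodMk (continuous_subtype_val.comp continuous_snd)))

theorem stretch_monotone (t : ℝ≥0) : Monotone (stretch t) :=
  (monotone_projIcc zero_le_one).comp
    ((dilate_strictMono t).monotone.comp (Subtype.mono_coe _))

theorem coe_stretch (t : ℝ≥0) (x : I) : (stretch t x : ℝ) = max 0 (min 1 (dilate t x)) :=
  coe_projIcc _ _ _ _

theorem stretch_eq_zero_iff : stretch t x = 0 ↔ dilate t x ≤ 0 :=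
  projIcc_eq_left zero_lt_one

theorem stretch_eq_one_iff : stretch t x = 1 ↔ 1 ≤ dilate t x :=
  projIcc_eq_right zero_lt_one

theorem stretch_endpt (t : ℝ≥0) (α : Bool) : stretch t (endpt α) = endpt α := by
  cases α
  · exact stretch_eq_zero_iff.2 (dilate_at_zero_nonpos t)
  · exact stretch_eq_one_iff.2 (one_le_dilate_at_one t)

theorem stretch_zero (x : I) : stretch 0 x = x := by
  rw [stretch, dilate_zero, projIcc_val]

theorem coe_stretch_of_ne_endpt (h : ∀ α, stretch t x ≠ endpt α) :
    (stretch t x : ℝ) = dilate t x := by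
  have h0 : 0 < dilate t x := not_le.1 (mt stretch_eq_zero_iff.2 (h false))
  have h1 : dilate t x < 1 := not_le.1 (mt stretch_eq_one_iff.2 (h true))
  rw [coe_stretch, min_eq_right h1.le, max_eq_right h0.le]

theorem stretch_injOn (t : ℝ≥0) : InjOn (stretch t) {x | ∀ α, stretch t x ≠ endpt α} :=
  fun x hx y hy h => Subtype.ext <| (dilate_strictMono t).injective <| by
    rw [← coe_stretch_of_ne_endpt hx, ← coe_stretch_of_ne_endpt hy, h]

theorem stretch_add (s t : ℝ≥0) (x : I) : stretch (s + t) x = stretch s (stretch t x) := by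
  have hmono := (dilate_strictMono s).monotone
  by_cases h : ∃ α, stretch t x = endpt α
  · obtain ⟨_ | _, h⟩ := h <;> rw [h, stretch_endpt]
    · refine stretch_eq_zero_iff.2 ?_
      rw [dilate_add]
      exact (hmono (stretch_eq_zero_iff.1 h)).trans (dilate_at_zero_nonpos s)
    · refine stretch_eq_one_iff.2 ?_
      rw [dilate_add]
      exact (one_le_dilate_at_one s).trans (hmono (stretch_eq_one_iff.1 h))
  · rw [stretch, stretch, coe_stretch_of_ne_endpt (not_exists.1 h), dilate_add]

theorem stretch_lt_half_iff : (stretch t x : ℝ) < 1 / 2 ↔ (x : ℝ) < 1 / 2 := by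
  rw [coe_stretch, max_lt_iff, min_lt_iff, dilate_lt_half_iff]
  norm_num

theorem half_lt_stretch_iff : 1 / 2 < (stretch t x : ℝ) ↔ 1 / 2 < (x : ℝ) := by
  rw [coe_stretch, lt_max_iff, lt_min_iff, half_lt_dilate_iff]
  norm_num

theorem stretch_eq_half_iff : (stretch t x : ℝ) = 1 / 2 ↔ (x : ℝ) = 1 / 2 := by
  simp only [le_antisymm_iff, ← not_lt, stretch_lt_half_iff, half_lt_stretch_iff]

theorem eventually_stretch_eq_zero (h : (x : ℝ) < 1 / 2) : ∀ᶠ t in atTop, stretch t x = 0 :=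
  ((tendsto_dilate_atBot h).eventually_le_atBot 0).mono fun _ => stretch_eq_zero_iff.2

theorem eventually_stretch_eq_one (h : 1 / 2 < (x : ℝ)) : ∀ᶠ t in atTop, stretch t x = 1 :=
  ((tendsto_dilate_atTop h).eventually_ge_atTop 1).mono fun _ => stretch_eq_one_iff.2

/-- The sets of points of `I` that the stretching by `t` pushes beyond the end point `α`
(`zone t (some α)`) and inside `I` (`zone t none`). The two points pushed to the end points exactly
are left out, so that the zones are open. -/
def zone (t : ℝ≥0) : Option Bool → Set I
  | some false => {x | dilate t x < 0}
  | some true => {x | 1 < dilate t x}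
  | none => {x | 0 < dilate t x ∧ dilate t x < 1}

theorem isOpen_zone (t : ℝ≥0) (o : Option Bool) : IsOpen (zone t o) := by
  have hc : Continuous fun x : I => dilate t x :=
    continuous_dilate.comp (continuous_const.prodMk continuous_subtype_val)
  match o with
  | some false => exact isOpen_lt hc continuous_const
  | some true => exact isOpen_lt continuous_const hc
  | none => exact (isOpen_lt continuous_const hc).inter (isOpen_lt hc continuous_const)

theorem pairwise_disjoint_zone (t : ℝ≥0) : Pairwise (Disjoint on zone t) := by
  intro o o' h
  refine Set.disjoint_left.2 fun x hx hx' => ?_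
  rcases o with _ | _ | _ <;> rcases o' with _ | _ | _ <;> simp [zone] at h hx hx' <;> linarith

theorem stretch_eq_endpt_of_mem_zone {α : Bool} (h : x ∈ zone t (some α)) :
    stretch t x = endpt α := by
  cases α
  · exact stretch_eq_zero_iff.2 (le_of_lt h)
  · exact stretch_eq_one_iff.2 (le_of_lt h)

theorem stretch_ne_endpt_of_mem_zone (h : x ∈ zone t none) (α : Bool) : stretch t x ≠ endpt α := by
  cases α
  · exact fun hx => (stretch_eq_zero_iff.1 hx).not_gt h.1
  · exact fun hx => (stretch_eq_one_iff.1 hx).not_gt h.2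

theorem endpt_mem_zone (ht : 0 < t) (α : Bool) : endpt α ∈ zone t (some α) := by
  have := Real.one_lt_exp_iff.2 (NNReal.coe_pos.2 ht)
  cases α <;> simp [zone, dilate, endpt] <;> linarith

end Stretch

variable {X : PrecubicalSet.{u}}

section StretchFlow

variable {ι : Type*} {s t : ℝ≥0}

/-- The stretching of all coordinates of a point of a cube. -/
noncomputable def stretchVec (t : ℝ≥0) (x : ι → I) : ι → I := fun i => stretch t (x i)

theorem continuous_stretchVec (t : ℝ≥0) : Continuous (stretchVec t : (ι → I) → ι → I) :=
  continuous_pi fun i => continuous_stretch.comp (continuous_const.prodMk (continuous_apply i))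

theorem stretchVec_monotone (t : ℝ≥0) : Monotone (stretchVec t : (ι → I) → ι → I) :=
  fun _ _ h i => stretch_monotone t (h i)

theorem stretchVec_add (s t : ℝ≥0) (x : ι → I) :
    stretchVec (s + t) x = stretchVec s (stretchVec t x) :=
  funext fun i => stretch_add s t (x i)

theorem stretchVec_endpt (t : ℝ≥0) (α : Bool) :
    stretchVec t (fun _ : ι => endpt α) = fun _ => endpt α :=
  funext fun _ => stretch_endpt t α

theorem stretchVec_insertNth {n : ℕ} (t : ℝ≥0) (i : Fin (n + 1)) (α : Bool) (x : Fin n → I) :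
    stretchVec t (i.insertNth (α := fun _ => I) (endpt α) x) =
      i.insertNth (α := fun _ => I) (endpt α) (stretchVec t x) := by
  refine Fin.eq_insertNth_iff.2 ⟨?_, funext fun j => ?_⟩ <;>
    simp [stretchVec, stretch_endpt, Fin.removeNth]

theorem exists_eq_pt (q : X.Realization) :
    ∃ (n : ℕ) (c : X.cube n) (x : Fin n → I), q = pt c x := by
  induction q using Quot.ind with
  | mk p => exact ⟨p.1.1, p.1.2, p.2, rfl⟩

theorem isQuotientMap_mk : IsQuotientMap (Quot.mk X.Glue : X.Cells → X.Realization) :=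
  isQuotientMap_quot_mk

theorem continuous_cellsMk {n : ℕ} (c : X.cube n) :
    Continuous fun x : Fin n → I => (⟨⟨n, c⟩, x⟩ : X.Cells) :=
  @continuous_sigmaMk (Σ n, X.cube n) (fun c => Fin c.1 → I) _ ⟨n, c⟩

theorem continuous_pt {n : ℕ} (c : X.cube n) : Continuous (pt c) :=
  isQuotientMap_mk.continuous.comp (continuous_cellsMk c)

variable (X) in
/-- The semiflow on `|X|` that stretches all coordinates of all cubes. -/
noncomputable def stretchFlow : Flow ℝ≥0 X.Realization where
  toFun t := Quot.map (fun p => ⟨p.1, stretchVec t p.2⟩) (by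
    rintro _ _ ⟨c, α, i, x⟩
    simpa only [stretchVec_insertNth] using Glue.glue c α i (stretchVec t x))
  cont' := by
    rw [← (Homeomorph.prodComm _ _).comp_continuous_iff']
    refine isQuotientMap_mk.continuous_lift_prod_left ?_
    rw [← Homeomorph.sigmaProdDistrib.symm.comp_continuous_iff', continuous_sigma_iff]
    rintro ⟨n, c⟩
    refine (continuous_pt c).comp (f := fun q : (Fin n → I) × ℝ≥0 => stretchVec q.2 q.1) ?_
    exact continuous_pi fun i => continuous_stretch.comp
      (continuous_snd.prodMk ((continuous_apply i).comp continuous_fst))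
  map_add' s t q := by
    obtain ⟨n, c, x, rfl⟩ := exists_eq_pt q
    exact congrArg (pt c) (stretchVec_add s t x)
  map_zero' q := by
    obtain ⟨n, c, x, rfl⟩ := exists_eq_pt q
    exact congrArg (pt c) (funext fun i => stretch_zero (x i))

theorem stretchFlow_pt (t : ℝ≥0) {n : ℕ} (c : X.cube n) (x : Fin n → I) :
    stretchFlow X t (pt c x) = pt c (stretchVec t x) := rfl

theorem stretchFlow_vpt (t : ℝ≥0) (v : X.cube 0) : stretchFlow X t (vpt v) = vpt v :=
  congrArg (pt v) (Subsingleton.elim _ _)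

variable (X) in
/-- The semiflow on the space of paths in `|X|` given by pointwise stretching. -/
noncomputable def pathFlow : Flow ℝ≥0 C(I, X.Realization) := mapsFlow I (stretchFlow X)

theorem pathFlow_apply (t : ℝ≥0) (p : C(I, X.Realization)) (s : I) :
    pathFlow X t p s = stretchFlow X t (p s) := rfl

end StretchFlow

section Faces

variable {k n : ℕ} {e : X.cube k} {c : X.cube n} {φ : Fin n → Bool ⊕ Fin k}

theorem faceMap_insertNth (α : Bool) (i : Fin (n + 1)) (φ : Fin n → Bool ⊕ Fin k) (z : Fin k → I) :
    faceMap (i.insertNth (α := fun _ => Bool ⊕ Fin k) (Sum.inl α) φ) z =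
      i.insertNth (α := fun _ => I) (endpt α) (faceMap φ z) := by
  refine Fin.eq_insertNth_iff.2 ⟨?_, funext fun j => ?_⟩ <;> simp [faceMap, Fin.removeNth]

theorem stretchVec_faceMap (t : ℝ≥0) (φ : Fin n → Bool ⊕ Fin k) (z : Fin k → I) :
    stretchVec t (faceMap φ z) = faceMap φ (stretchVec t z) := by
  funext i
  simp only [stretchVec, faceMap]
  cases φ i with
  | inl α => exact stretch_endpt t α
  | inr j => rfl

theorem stretchVec_eq_faceMap {t : ℝ≥0} {y : Fin n → I} {z : Fin k → I}
    (hfix : ∀ i α, φ i = Sum.inl α → stretch t (y i) = endpt α)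
    (hfree : ∀ i j, φ i = Sum.inr j → y i = z j) :
    stretchVec t y = faceMap φ (stretchVec t z) := by
  funext i
  simp only [stretchVec, faceMap]
  cases h : φ i with
  | inl α => exact hfix i α h
  | inr j => exact congrArg (stretch t) (hfree i j h)

theorem continuous_faceMap (φ : Fin n → Bool ⊕ Fin k) : Continuous (faceMap φ) := by
  refine continuous_pi fun i => ?_
  simp only [faceMap]
  cases φ i with
  | inl α => exact continuous_const
  | inr j => exact continuous_apply j

theorem faceMap_monotone (φ : Fin n → Bool ⊕ Fin k) : Monotone (faceMap φ) := by
  intro z z' h i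
  simp only [faceMap]
  cases φ i with
  | inl α => exact le_rfl
  | inr j => exact h j

theorem pt_face (c : X.cube (n + 1)) (α : Bool) (i : Fin (n + 1)) (x : Fin n → I) :
    pt (X.face α i c) x = pt c (i.insertNth (α := fun _ => I) (endpt α) x) :=
  Quot.sound (Glue.glue c α i x)

theorem pt_corner (α : Bool) (c : X.cube n) : pt c (fun _ => endpt α) = vpt (X.corner α c) := by
  induction n with
  | zero => exact congrArg (pt c) (Subsingleton.elim _ _)
  | succ n ih =>
    rw [corner, ← ih, pt_face]
    congr 1
    funext j
    induction j using Fin.cases <;> simp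

theorem IsFace.pt_eq (h : IsFace e c φ) (z : Fin k → I) : pt c (faceMap φ z) = pt e z := by
  induction h with
  | refl c => rfl
  | step c α i φ h ih => rw [faceMap_insertNth, ← pt_face, ih]

theorem IsFace.exists_index (h : IsFace e c φ) :
    ∃ f : Fin k → Fin n, ∀ i j, φ i = Sum.inr j ↔ i = f j := by
  induction h with
  | refl _ => exact ⟨id, fun i j => by simp⟩
  | step _ _ i _ _ ih =>
    obtain ⟨f, hf⟩ := ih
    refine ⟨fun j => i.succAbove (f j), fun i' j => ?_⟩
    induction i' using i.succAboveCases with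
    | x => simp [(Fin.succAbove_ne i _).symm]
    | p i' => simp [hf]

theorem IsFace.cells_eq_of_forall_ne_inl (h : IsFace e c φ) (hφ : ∀ i α, φ i ≠ Sum.inl α)
    (z : Fin k → I) : (⟨⟨k, e⟩, z⟩ : X.Cells) = ⟨⟨n, c⟩, faceMap φ z⟩ := by
  cases h with
  | refl => rfl
  | step _ α i φ h => exact absurd (by simp) (hφ i α)

theorem face_face_predAbove (α β : Bool) (i : Fin (n + 2)) (j : Fin (n + 1))
    (c : X.cube (n + 2)) :
    X.face α j (X.face β i c) = X.face β (j.predAbove i) (X.face α (i.succAbove j) c) := by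
  rcases lt_or_ge j.castSucc i with h | h
  · obtain ⟨i, rfl⟩ := Fin.exists_succ_eq.2 (Fin.ne_zero_of_lt h)
    rw [Fin.succAbove_of_castSucc_lt _ _ h, Fin.predAbove_of_castSucc_lt _ _ h, Fin.pred_succ]
    exact X.face_face α β j i (Fin.castSucc_lt_succ_iff.1 h) c
  · obtain ⟨i, rfl⟩ := Fin.exists_castSucc_eq.2 (h.trans_lt (Fin.castSucc_lt_last j)).ne
    rw [Fin.succAbove_of_le_castSucc _ _ h, Fin.predAbove_of_le_castSucc _ _ h,
      Fin.castPred_castSucc]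
    exact (X.face_face β α i j (Fin.castSucc_le_castSucc_iff.1 h) c).symm

theorem IsFace.comp_succAbove {c : X.cube (n + 1)} {φ : Fin (n + 1) → Bool ⊕ Fin k}
    (h : IsFace e c φ) {i : Fin (n + 1)} {α : Bool} (hi : φ i = Sum.inl α) :
    IsFace e (X.face α i c) (fun j => φ (i.succAbove j)) := by
  induction n with
  | zero =>
    cases h with
    | refl => simp at hi
    | step _ β j φ h =>
      obtain rfl : j = i := Subsingleton.elim (α := Fin 1) _ _
      obtain rfl : β = α := by simpa using hi
      simpa using h
  | succ n ih =>
    cases h with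
    | refl => simp at hi
    | step _ β j φ h =>
      obtain rfl | ⟨l, rfl⟩ : i = j ∨ ∃ l, j.succAbove l = i :=
        or_iff_not_imp_left.2 Fin.exists_succAbove_eq
      · obtain rfl : β = α := by simpa using hi
        simpa using h
      · have hface := ih h (i := l) (by simpa using hi)
        rw [face_face_predAbove] at hface
        convert IsFace.step _ β (l.predAbove j) _ hface using 1
        refine Fin.eq_insertNth_iff.2 ⟨?_, funext fun m => ?_⟩
        · rw [Fin.succAbove_succAbove_predAbove, Fin.insertNth_apply_same]
        · rw [Fin.removeNth, Fin.succAbove_succAbove_succAbove_predAbove,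
            Fin.insertNth_apply_succAbove]

theorem exists_carrier (c : X.cube n) (x : Fin n → I) :
    ∃ (k : ℕ) (e : X.cube k) (φ : Fin n → Bool ⊕ Fin k) (z : Fin k → I),
      IsFace e c φ ∧ x = faceMap φ z ∧ ∀ j α, z j ≠ endpt α := by
  induction n with
  | zero => exact ⟨0, c, Sum.inr, x, .refl c, rfl, fun j => j.elim0⟩
  | succ n ih =>
    by_cases h : ∃ i α, x i = endpt α
    · obtain ⟨i, α, hi⟩ := h
      obtain ⟨k, e, φ, z, he, hx, hz⟩ := ih (X.face α i c) (fun j => x (i.succAbove j))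
      refine ⟨k, e, _, z, .step c α i φ he, ?_, hz⟩
      rw [faceMap_insertNth, ← hx, ← hi]
      exact (Fin.insertNth_self_removeNth i x).symm
    · push Not at h
      exact ⟨n + 1, c, Sum.inr, x, .refl c, rfl, h⟩

theorem exists_eq_pt_interior (q : X.Realization) :
    ∃ (k : ℕ) (e : X.cube k) (z : Fin k → I), q = pt e z ∧ ∀ j α, z j ≠ endpt α := by
  obtain ⟨n, c, x, rfl⟩ := exists_eq_pt q
  obtain ⟨k, e, φ, z, he, rfl, hz⟩ := exists_carrier c x
  exact ⟨k, e, z, he.pt_eq z, hz⟩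

end Faces

section CellNhd

variable {k n : ℕ} {e : X.cube k} {c : X.cube n} {φ : Fin n → Bool ⊕ Fin k} {Z : Bool → Set I}
  {U : Set (Fin k → I)}

/-- The product of the sets `Z α` in the fixed coordinates and of `U` in the free coordinates of
the face `φ` of a cube. -/
def faceNhd (Z : Bool → Set I) (U : Set (Fin k → I)) (φ : Fin n → Bool ⊕ Fin k) :
    Set (Fin n → I) :=
  {y | (∀ i α, φ i = Sum.inl α → y i ∈ Z α) ∧ ∃ w ∈ U, ∀ i j, φ i = Sum.inr j → y i = w j}

/-- The union of the sets `faceNhd Z U φ` over all cubes that have `e` as the iterated face `φ`. -/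
def cellNhd (e : X.cube k) (Z : Bool → Set I) (U : Set (Fin k → I)) : Set X.Realization :=
  {q | ∃ (n : ℕ) (c : X.cube n) (φ : Fin n → Bool ⊕ Fin k), IsFace e c φ ∧
    ∃ y ∈ faceNhd Z U φ, pt c y = q}

theorem IsFace.isOpen_faceNhd (h : IsFace e c φ) (hZ : ∀ α, IsOpen (Z α)) (hU : IsOpen U) :
    IsOpen (faceNhd Z U φ) := by
  obtain ⟨f, hf⟩ := h.exists_index
  have heq : faceNhd Z U φ = (⋂ (i) (α) (_ : φ i = Sum.inl α), (fun y => y i) ⁻¹' Z α) ∩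
      (fun y j => y (f j)) ⁻¹' U := by
    ext y
    simp only [faceNhd, hf, mem_inter_iff, mem_iInter, mem_preimage, mem_ofPred_eq]
    refine and_congr_right fun _ => ⟨fun ⟨w, hw, hy⟩ => ?_, fun hy => ⟨_, hy, ?_⟩⟩
    · rwa [show (fun j => y (f j)) = w from funext fun j => hy _ _ rfl]
    · rintro _ j rfl
      rfl
  rw [heq]
  refine .inter (isOpen_iInter_of_finite fun i => isOpen_iInter_of_finite fun α =>
    isOpen_iInter_of_finite fun _ => (hZ α).preimage (continuous_apply i)) (hU.preimage ?_)
  fun_prop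

theorem exists_isFace_glue_iff (hZ : ∀ α β, endpt α ∈ Z β ↔ α = β)
    (hU : ∀ w ∈ U, ∀ j α, w j ≠ endpt α) {c : X.cube (n + 1)} {α : Bool} {i : Fin (n + 1)}
    {x : Fin n → I} :
    (∃ φ, IsFace e (X.face α i c) φ ∧ x ∈ faceNhd Z U φ) ↔
      ∃ φ, IsFace e c φ ∧ i.insertNth (α := fun _ => I) (endpt α) x ∈ faceNhd Z U φ := by
  constructor
  · rintro ⟨φ, hφ, hfix, w, hw, hfree⟩
    refine ⟨_, .step c α i φ hφ, ?_, w, hw, ?_⟩ <;>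
      refine (Fin.forall_iff_succAbove i).2 ⟨?_, fun l => ?_⟩
    · simp [hZ]
    · simpa using hfix l
    · simp
    · simpa using hfree l
  · rintro ⟨φ, hφ, hfix, w, hw, hfree⟩
    have hi : φ i = Sum.inl α := by
      cases h : φ i with
      | inl β => rw [(hZ α β).1 (by simpa using hfix i β h)]
      | inr j => exact absurd (hfree i j h).symm (by simpa using hU w hw j α)
    exact ⟨_, hφ.comp_succAbove hi, fun l β hl => by simpa using hfix _ β hl,
      w, hw, fun l j hl => by simpa using hfree _ j hl⟩

theorem pt_mem_cellNhd_iff (hZ : ∀ α β, endpt α ∈ Z β ↔ α = β)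
    (hU : ∀ w ∈ U, ∀ j α, w j ≠ endpt α) {y : Fin n → I} :
    pt c y ∈ cellNhd e Z U ↔ ∃ φ, IsFace e c φ ∧ y ∈ faceNhd Z U φ := by
  refine ⟨?_, fun ⟨φ, hφ, hy⟩ => ⟨n, c, φ, hφ, y, hy, rfl⟩⟩
  rintro ⟨m, d, ψ, hψ, z, hz, hzy⟩
  let P : X.Cells → Prop := fun p => ∃ φ, IsFace e p.1.2 φ ∧ p.2 ∈ faceNhd Z U φ
  have hP : ∀ p q, X.Glue p q → P p = P q := by
    rintro _ _ ⟨c, α, i, x⟩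
    exact propext (exists_isFace_glue_iff hZ hU)
  exact (congrArg (Quot.lift P hP) hzy).mp ⟨ψ, hψ, hz⟩

theorem isOpen_cellNhd (hZ : ∀ α β, endpt α ∈ Z β ↔ α = β) (hU : ∀ w ∈ U, ∀ j α, w j ≠ endpt α)
    (hZo : ∀ α, IsOpen (Z α)) (hUo : IsOpen U) : IsOpen (cellNhd e Z U) := by
  refine isQuotientMap_mk.isOpen_preimage.1 (isOpen_sigma_iff.2 ?_)
  rintro ⟨n, c⟩
  have heq : (pt c ⁻¹' cellNhd e Z U) = ⋃ (φ) (_ : IsFace e c φ), faceNhd Z U φ := by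
    ext y
    simp only [mem_preimage, pt_mem_cellNhd_iff hZ hU, mem_iUnion, exists_prop]
  change IsOpen (pt c ⁻¹' cellNhd e Z U)
  rw [heq]
  exact isOpen_biUnion fun φ hφ => hφ.isOpen_faceNhd hZo hUo

theorem pt_eq_pt_iff_exists_isFace {z : Fin k → I} (hz : ∀ j α, z j ≠ endpt α) {y : Fin n → I} :
    pt c y = pt e z ↔ ∃ φ, IsFace e c φ ∧ y = faceMap φ z := by
  refine ⟨fun h => ?_, fun ⟨φ, hφ, hy⟩ => hy ▸ hφ.pt_eq z⟩
  have hmem : pt c y ∈ cellNhd e (fun α => {endpt α}) {z} :=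
    ⟨k, e, Sum.inr, .refl e, z, ⟨by simp, z, rfl, by simp⟩, h.symm⟩
  obtain ⟨φ, hφ, hfix, w, rfl, hfree⟩ := (pt_mem_cellNhd_iff
    (by intro α β; cases α <;> cases β <;> simp [endpt]) (by simpa using hz)).1 hmem
  refine ⟨φ, hφ, funext fun i => ?_⟩
  simp only [faceMap]
  cases h : φ i with
  | inl α => exact hfix i α h
  | inr j => exact hfree i j h

theorem cells_eq_of_pt_eq {y : Fin n → I} {z : Fin k → I} (hy : ∀ i α, y i ≠ endpt α)
    (hz : ∀ j α, z j ≠ endpt α) (h : pt c y = pt e z) :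
    (⟨⟨n, c⟩, y⟩ : X.Cells) = ⟨⟨k, e⟩, z⟩ := by
  obtain ⟨φ, hφ, rfl⟩ := (pt_eq_pt_iff_exists_isFace hz).1 h
  refine (hφ.cells_eq_of_forall_ne_inl (fun i α hi => hy i α ?_) z).symm
  simp [faceMap, hi]

/-- The points of `I^k` that the stretching by `t` keeps inside `I^k`. -/
def core (t : ℝ≥0) (k : ℕ) : Set (Fin k → I) := {w | ∀ j, w j ∈ zone t none}

theorem isOpen_core (t : ℝ≥0) (k : ℕ) : IsOpen (core t k) := by
  simp only [core, ofPred_forall]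
  exact isOpen_iInter_of_finite fun j => (isOpen_zone t none).preimage (continuous_apply j)

theorem stretchVec_injOn_core (t : ℝ≥0) : InjOn (stretchVec t) (core t k) := fun _ hw _ hw' h =>
  funext fun j => stretch_injOn t (stretch_ne_endpt_of_mem_zone (hw j))
    (stretch_ne_endpt_of_mem_zone (hw' j)) (congrFun h j)

theorem eventually_mem_core {z : Fin k → I} (hz : ∀ j α, z j ≠ endpt α) :
    ∀ᶠ t in 𝓝 0, z ∈ core t k := by
  refine eventually_all.2 fun j => ?_
  have hc : ContinuousAt (fun t => dilate t (z j)) 0 :=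
    (continuous_dilate.comp (continuous_id.prodMk continuous_const)).continuousAt
  have hlim : Tendsto (fun t => dilate t (z j)) (𝓝 0) (𝓝 (z j)) := by
    simpa only [ContinuousAt, dilate_zero] using hc
  exact hlim.eventually_mem (Ioo_mem_nhds (unitInterval.pos_iff_ne_zero.2 (hz j false))
    (unitInterval.lt_one_iff_ne_one.2 (hz j true)))

variable {t : ℝ≥0}

theorem endpt_mem_zone_iff (ht : 0 < t) (α β : Bool) : endpt α ∈ zone t (some β) ↔ α = β := by
  refine ⟨fun h => ?_, fun h => h ▸ endpt_mem_zone ht α⟩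
  by_contra hne
  exact (pairwise_disjoint_zone t fun hs => hne (Option.some.inj hs)).le_bot
    ⟨endpt_mem_zone ht α, h⟩

theorem ne_endpt_of_mem_core (ht : 0 < t) {w : Fin k → I} (hw : w ∈ core t k) (j : Fin k)
    (α : Bool) : w j ≠ endpt α := fun h =>
  (pairwise_disjoint_zone t (Option.some_ne_none α)).le_bot ⟨endpt_mem_zone ht α, h ▸ hw j⟩

theorem stretchVec_eq_faceMap_of_forall_mem_zone {y : Fin n → I} {z : Fin k → I}
    (hfix : ∀ i α, φ i = Sum.inl α → y i ∈ zone t (some α))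
    (hfree : ∀ i j, φ i = Sum.inr j → y i = z j) :
    stretchVec t y = faceMap φ (stretchVec t z) :=
  stretchVec_eq_faceMap (fun i α h => stretch_eq_endpt_of_mem_zone (hfix i α h)) hfree

variable (e) in
/-- A neighbourhood in `|X|` of the image of `U ⊆ core t k` in the cell of `e`, which the stretching
by `t` moves into this cell. -/
def stretchNhd (t : ℝ≥0) (U : Set (Fin k → I)) : Set X.Realization :=
  cellNhd e (fun α => zone t (some α)) U

theorem isOpen_stretchNhd (ht : 0 < t) (hUo : IsOpen U) (hU : U ⊆ core t k) :
    IsOpen (stretchNhd e t U) :=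
  isOpen_cellNhd (endpt_mem_zone_iff ht) (fun _ hw => ne_endpt_of_mem_core ht (hU hw))
    (fun α => isOpen_zone t (some α)) hUo

theorem pt_mem_stretchNhd {z : Fin k → I} (hz : z ∈ U) : pt e z ∈ stretchNhd e t U :=
  ⟨k, e, Sum.inr, .refl e, z, ⟨by simp, z, hz, by simp⟩, rfl⟩

theorem exists_stretchFlow_eq_of_mem_stretchNhd {q : X.Realization} (hq : q ∈ stretchNhd e t U) :
    ∃ w ∈ U, stretchFlow X t q = pt e (stretchVec t w) := by
  obtain ⟨n, c, φ, hφ, y, ⟨hfix, w, hw, hfree⟩, rfl⟩ := hq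
  refine ⟨w, hw, ?_⟩
  rw [stretchFlow_pt, stretchVec_eq_faceMap_of_forall_mem_zone hfix hfree, hφ.pt_eq]

instance : T2Space X.Realization := by
  refine ⟨fun p q hpq => ?_⟩
  obtain ⟨k, e, z, rfl, hz⟩ := exists_eq_pt_interior p
  obtain ⟨m, d, w, rfl, hw⟩ := exists_eq_pt_interior q
  obtain ⟨t, ht : 0 < t, hzt, hwt⟩ := (Eventually.and (self_mem_nhdsWithin (s := Ioi (0 : ℝ≥0)))
    (nhdsWithin_le_nhds ((eventually_mem_core hz).and (eventually_mem_core hw)))).exists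
  obtain ⟨O, O', hO, hO', hzO, hwO', hdisj⟩ := t2_separation
    (show (⟨⟨k, e⟩, z⟩ : X.Cells) ≠ ⟨⟨m, d⟩, w⟩ from fun h => hpq (congrArg (Quot.mk _) h))
  have hopen {l : ℕ} (b : X.cube l) {O : Set X.Cells} (hO : IsOpen O) :
      IsOpen (stretchNhd b t (core t l ∩ (fun w => ⟨⟨l, b⟩, w⟩) ⁻¹' O)) :=
    isOpen_stretchNhd ht ((isOpen_core t l).inter (hO.preimage (continuous_cellsMk b)))
      inter_subset_left
  refine ⟨_, _, hopen e hO, hopen d hO', pt_mem_stretchNhd ⟨hzt, hzO⟩,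
    pt_mem_stretchNhd ⟨hwt, hwO'⟩, ?_⟩
  refine Set.disjoint_left.2 fun r hr hr' => ?_
  obtain ⟨v, ⟨hv, hvO⟩, hrv⟩ := exists_stretchFlow_eq_of_mem_stretchNhd hr
  obtain ⟨v', ⟨hv', hvO'⟩, hrv'⟩ := exists_stretchFlow_eq_of_mem_stretchNhd hr'
  have hcells := cells_eq_of_pt_eq (fun j => stretch_ne_endpt_of_mem_zone (hv j))
    (fun j => stretch_ne_endpt_of_mem_zone (hv' j)) (hrv.symm.trans hrv')
  obtain ⟨hed, hvv'⟩ := Sigma.mk.inj hcells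
  obtain ⟨rfl, hed⟩ := Sigma.mk.inj hed
  obtain rfl := eq_of_heq hed
  obtain rfl := stretchVec_injOn_core t hv hv' (eq_of_heq hvv')
  exact hdisj.le_bot ⟨hvO, hvO'⟩

end CellNhd

section Paths

variable {n : ℕ} {p : C(I, X.Realization)} {c : X.cube n} {β γ : I → Fin n → I} {a b a' b' m : I}

theorem IsSubdivision.exists_mem_Icc {l : ℕ} {t : Fin (l + 1) → I} (ht : IsSubdivision t) (s : I) :
    ∃ k : Fin l, s ∈ Icc (t k.castSucc) (t k.succ) := by
  have hl : l ≠ 0 := by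
    rintro rfl
    exact zero_ne_one (ht.2.1.symm.trans ht.2.2)
  have hle : ∀ k : Fin (l + 1), s ≤ t k → ∃ k : Fin l, s ∈ Icc (t k.castSucc) (t k.succ) := by
    intro k
    induction k using Fin.induction with
    | zero =>
      intro h
      obtain ⟨l, rfl⟩ := Nat.exists_eq_succ_of_ne_zero hl
      exact ⟨0, by simp [ht.2.1], h.trans (ht.1 (Fin.zero_le _))⟩
    | succ k ih => exact fun h => (le_total s (t k.castSucc)).elim ih fun h' => ⟨k, h', h⟩
  exact hle (Fin.last l) (ht.2.2 ▸ le_one')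

theorem IsSubdivision.interval_induction {l : ℕ} {t : Fin (l + 1) → I} (ht : IsSubdivision t)
    {Q : I → I → Prop}
    (piece : ∀ k : Fin l, ∀ a b, a ≤ b → t k.castSucc ≤ a → b ≤ t k.succ → Q a b)
    (trans : ∀ a b c, a ≤ b → b ≤ c → Q a b → Q b c → Q a c) (hab : a ≤ b) : Q a b := by
  have hle : ∀ k : Fin (l + 1), ∀ a b, a ≤ b → b ≤ t k → Q a b := by
    intro k
    induction k using Fin.induction with
    | zero =>
      intro a b hab hb
      rw [ht.2.1] at hb
      obtain rfl : b = 0 := le_antisymm hb nonneg'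
      obtain rfl : a = 0 := le_antisymm hab nonneg'
      obtain ⟨k, hk⟩ := ht.exists_mem_Icc 0
      exact piece k 0 0 le_rfl hk.1 hk.2
    | succ k ih =>
      intro a b hab hb
      rcases le_total b (t k.castSucc) with hbt | htb
      · exact ih a b hab hbt
      rcases le_total (t k.castSucc) a with hta | hat
      · exact piece k a b hab hta hb
      · exact trans _ _ _ hat htb (ih _ _ hat le_rfl) (piece k _ _ htb le_rfl hb)
  exact hle (Fin.last l) a b hab (ht.2.2 ▸ le_one')

theorem Increasing.mono (h : Increasing β a b) (hsub : Icc a' b' ⊆ Icc a b) :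
    Increasing β a' b' :=
  ⟨h.1.mono hsub, h.2.mono hsub⟩

theorem Presents.mono (h : Presents p a b c β) (hsub : Icc a' b' ⊆ Icc a b) :
    Presents p a' b' c β :=
  fun s hs => h s (hsub hs)

theorem IsDPath.interval_induction (hp : IsDPath p) {Q : I → I → Prop}
    (piece : ∀ a b, a ≤ b → ∀ (n : ℕ) (c : X.cube n) (β : I → Fin n → I),
      Increasing β a b → Presents p a b c β → Q a b)
    (trans : ∀ a b c, a ≤ b → b ≤ c → Q a b → Q b c → Q a c) (hab : a ≤ b) : Q a b := by
  obtain ⟨l, t, ht, h⟩ := hp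
  refine ht.interval_induction (fun k a b hab ha hb => ?_) trans hab
  obtain ⟨n, c, β, hβ, hpr⟩ := h k
  have hsub : Icc a b ⊆ Icc (t k.castSucc) (t k.succ) := Icc_subset_Icc ha hb
  exact piece a b hab n c β (hβ.mono hsub) (hpr.mono hsub)

theorem IsStrict.isDPath (h : IsStrict p) : IsDPath p := by
  obtain ⟨l, t, ht, h⟩ := h
  refine ⟨l, t, ht, fun k => ?_⟩
  obtain ⟨n, c, β, hβ, hpr⟩ := h k
  exact ⟨n, c, β, hβ.1, hpr⟩

theorem Increasing.ite (hβ : Increasing β a m) (hγ : Increasing γ m b) (h : β m = γ m) :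
    Increasing (fun s => if s ≤ m then β s else γ s) a b := by
  have hleft : EqOn (fun s => if s ≤ m then β s else γ s) β (Icc a m) := fun s hs => if_pos hs.2
  have hright : EqOn (fun s => if s ≤ m then β s else γ s) γ (Icc m b) := fun s hs => by
    rcases hs.1.eq_or_lt with rfl | hlt
    · simp [h]
    · exact if_neg hlt.not_ge
  constructor
  · have hc := (hβ.1.congr hleft).union_of_isClosed (hγ.1.congr hright) isClosed_Icc isClosed_Icc
    exact hc.mono fun s hs => (le_total s m).imp (fun h => ⟨hs.1, h⟩) (fun h => ⟨h, hs.2⟩)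
  · rcases le_total a m with ham | hma
    · rcases le_total m b with hmb | hbm
      · rw [← Icc_union_Icc_eq_Icc ham hmb]
        exact (hβ.2.congr hleft.symm).union_right (hγ.2.congr hright.symm)
          (isGreatest_Icc ham) (isLeast_Icc hmb)
      · exact (hβ.2.congr hleft.symm).mono (Icc_subset_Icc_right hbm)
    · exact (hγ.2.congr hright.symm).mono (Icc_subset_Icc_left hma)

theorem Presents.ite (hβ : Presents p a m c β) (hγ : Presents p m b c γ) :
    Presents p a b c (fun s => if s ≤ m then β s else γ s) := by
  intro s hs
  dsimp only
  split_ifs with hsm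
  · exact hβ s ⟨hs.1, hsm⟩
  · exact hγ s ⟨(not_le.1 hsm).le, hs.2⟩

/-- Over `[a,b]` the path `p` is a directed path in the cube `d` from `x` to `y`. -/
def RunsIn (p : C(I, X.Realization)) (d : X.cube n) (a b : I) (x y : Fin n → I) : Prop :=
  ∃ β : I → Fin n → I, Increasing β a b ∧ Presents p a b d β ∧ β a = x ∧ β b = y

theorem RunsIn.trans {x y z : Fin n → I} (ham : a ≤ m) (hmb : m ≤ b) (h : RunsIn p c a m x y)
    (h' : RunsIn p c m b y z) : RunsIn p c a b x z := by
  obtain ⟨β, hβ, hpβ, rfl, hβm⟩ := h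
  obtain ⟨γ, hγ, hpγ, hγm, rfl⟩ := h'
  refine ⟨_, hβ.ite hγ (hβm.trans hγm.symm), hpβ.ite hpγ, if_pos ham, ?_⟩
  rcases hmb.eq_or_lt with rfl | hlt
  · rw [if_pos le_rfl, hβm, hγm]
  · exact if_neg hlt.not_ge

theorem Increasing.stretchVec (h : Increasing β a b) (t : ℝ≥0) :
    Increasing (fun s => stretchVec t (β s)) a b :=
  ⟨(continuous_stretchVec t).comp_continuousOn h.1, (stretchVec_monotone t).comp_monotoneOn h.2⟩

theorem Presents.stretchVec (h : Presents p a b c β) (t : ℝ≥0) :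
    Presents (pathFlow X t p) a b c (fun s => stretchVec t (β s)) := fun s hs => by
  rw [pathFlow_apply, h s hs, stretchFlow_pt]

theorem RunsIn.pathFlow {x y : Fin n → I} (h : RunsIn p c a b x y) (t : ℝ≥0) :
    RunsIn (pathFlow X t p) c a b (PrecubicalSet.stretchVec t x)
      (PrecubicalSet.stretchVec t y) := by
  obtain ⟨β, hβ, hp, rfl, rfl⟩ := h
  exact ⟨_, hβ.stretchVec t, hp.stretchVec t, rfl, rfl⟩

theorem Increasing.exists_lift {k l : ℕ} {e : X.cube k} {d : X.cube l} {φ : Fin n → Bool ⊕ Fin k}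
    {ψ : Fin l → Bool ⊕ Fin k} (hβ : Increasing β a b) (hp : Presents p a b c β)
    (hφ : IsFace e c φ) (hψ : IsFace e d ψ) {t : ℝ≥0}
    (hfix : ∀ s ∈ Icc a b, ∀ i α, φ i = Sum.inl α → stretch t (β s i) = endpt α) :
    ∃ z : I → Fin k → I, (∀ s i j, φ i = Sum.inr j → β s i = z s j) ∧
      Increasing (fun s => faceMap ψ (PrecubicalSet.stretchVec t (z s))) a b ∧
      Presents (PrecubicalSet.pathFlow X t p) a b d
        (fun s => faceMap ψ (PrecubicalSet.stretchVec t (z s))) := by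
  obtain ⟨f, hf⟩ := hφ.exists_index
  have hfree : ∀ s i j, φ i = Sum.inr j → β s i = β s (f j) := fun s i j hij =>
    congrArg (β s) ((hf i j).1 hij)
  refine ⟨fun s j => β s (f j), hfree, ⟨?_, ?_⟩, fun s hs => ?_⟩
  · exact ((continuous_faceMap ψ).comp (continuous_stretchVec t)).comp_continuousOn
      (continuousOn_pi.2 fun j => continuousOn_pi.1 hβ.1 (f j))
  · exact ((faceMap_monotone ψ).comp (stretchVec_monotone t)).comp_monotoneOn
      fun s hs s' hs' hle j => hβ.2 hs hs' hle (f j)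
  · rw [pathFlow_apply, hp s hs, stretchFlow_pt,
      stretchVec_eq_faceMap (hfix s hs) (hfree s), hφ.pt_eq, hψ.pt_eq]

end Paths

section Lifting

variable {k l n : ℕ} {e : X.cube k} {c : X.cube n} {d : X.cube l} {φ : Fin n → Bool ⊕ Fin k}
  {ψ : Fin l → Bool ⊕ Fin k} {t : ℝ≥0} {p : C(I, X.Realization)} {a b : I}

/-- The interior of the face of `I^n` given by `φ`. -/
def openFace (φ : Fin n → Bool ⊕ Fin k) : Set (Fin n → I) :=
  faceMap φ '' {z | ∀ j α, z j ≠ endpt α}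

theorem IsFace.injOn_pt_openFace (h : IsFace e c φ) : InjOn (pt c) (openFace φ) := by
  rintro _ ⟨z, hz, rfl⟩ _ ⟨z', hz', rfl⟩ hzz'
  rw [h.pt_eq, h.pt_eq] at hzz'
  obtain rfl : z = z' := by simpa using cells_eq_of_pt_eq hz hz' hzz'
  rfl

/-- The points of `I^n` that the stretching by `t` moves into the interior of the face `φ`, up to
some boundary points; they form an open set. -/
def faceBasin (t : ℝ≥0) (φ : Fin n → Bool ⊕ Fin k) : Set (Fin n → I) :=
  faceNhd (fun α => zone t (some α)) (core t k) φ

theorem stretchVec_mem_openFace {y : Fin n → I} (hy : y ∈ faceBasin t φ) :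
    stretchVec t y ∈ openFace φ := by
  obtain ⟨hfix, w, hw, hfree⟩ := hy
  exact ⟨stretchVec t w, fun j => stretch_ne_endpt_of_mem_zone (hw j),
    (stretchVec_eq_faceMap_of_forall_mem_zone hfix hfree).symm⟩

theorem faceMap_mem_faceBasin (ht : 0 < t) {z : Fin k → I} (hz : z ∈ core t k) :
    faceMap φ z ∈ faceBasin t φ :=
  ⟨fun i α hi => by simpa [faceMap, hi] using endpt_mem_zone ht α, z, hz,
    fun i j hi => by simp [faceMap, hi]⟩

theorem pt_mem_stretchNhd_core_iff (ht : 0 < t) {y : Fin n → I} :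
    pt c y ∈ stretchNhd e t (core t k) ↔ ∃ φ, IsFace e c φ ∧ y ∈ faceBasin t φ :=
  pt_mem_cellNhd_iff (endpt_mem_zone_iff ht) fun _ hw => ne_endpt_of_mem_core ht hw

theorem exists_forall_mem_faceBasin (hab : a ≤ b) {β : I → Fin n → I}
    (hβ : ContinuousOn β (Icc a b))
    (h : ∀ s ∈ Icc a b, ∃ φ, IsFace e c φ ∧ β s ∈ faceBasin t φ) :
    ∃ φ, IsFace e c φ ∧ ∀ s ∈ Icc a b, β s ∈ faceBasin t φ := by
  obtain ⟨φ, hφ, hfix, w, hw, hfree⟩ := h a (left_mem_Icc.2 hab)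
  have hzone : ∀ s ∈ Icc a b, ∀ i, ∃ o, β s i ∈ zone t o := by
    intro s hs i
    obtain ⟨φ', -, hfix', w', hw', hfree'⟩ := h s hs
    cases hi : φ' i with
    | inl α => exact ⟨some α, hfix' i α hi⟩
    | inr j => exact ⟨none, hfree' i j hi ▸ hw' j⟩
  have hstay : ∀ i o, β a i ∈ zone t o → ∀ s ∈ Icc a b, β s i ∈ zone t o := by
    intro i o ha s hs
    have hsub : (fun s => β s i) '' Icc a b ⊆ ⋃ o, zone t o :=
      image_subset_iff.2 fun s hs => mem_iUnion.2 (hzone s hs i)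
    exact subset_of_isPreconnected_of_subset_iUnion
      (isPreconnected_Icc.image _ (continuousOn_pi.1 hβ i)) (isOpen_zone t)
      (pairwise_disjoint_zone t) hsub (mem_image_of_mem _ (left_mem_Icc.2 hab)) ha
      (mem_image_of_mem _ hs)
  obtain ⟨f, hf⟩ := hφ.exists_index
  refine ⟨φ, hφ, fun s hs => ⟨fun i α hi => hstay i _ (hfix i α hi) s hs,
    fun j => β s (f j), fun j => ?_, fun i j hi => congrArg (β s) ((hf i j).1 hi)⟩⟩
  refine hstay _ _ ?_ s hs
  rw [hfree (f j) j ((hf _ _).2 rfl)]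
  exact hw j

theorem IsDPath.exists_lift (hp : IsDPath p) (hψ : IsFace e d ψ) (ht : 0 < t) (hab : a ≤ b)
    (hV : MapsTo p (Icc a b) (stretchNhd e t (core t k))) :
    ∃ v : I → Fin l → I, Increasing v a b ∧ Presents (pathFlow X t p) a b d v ∧
      MapsTo v (Icc a b) (openFace ψ) := by
  revert hV
  refine hp.interval_induction (Q := fun a b => MapsTo p (Icc a b) (stretchNhd e t (core t k)) →
    ∃ v : I → Fin l → I, Increasing v a b ∧ Presents (pathFlow X t p) a b d v ∧
      MapsTo v (Icc a b) (openFace ψ)) ?_ ?_ hab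
  · intro a b hab n c β hβ hpr hV
    obtain ⟨φ, hφ, hmem⟩ := exists_forall_mem_faceBasin hab hβ.1 fun s hs =>
      (pt_mem_stretchNhd_core_iff ht).1 (hpr s hs ▸ hV hs)
    obtain ⟨z, hz, hinc, hpres⟩ := hβ.exists_lift hpr hφ hψ fun s hs i α hi =>
      stretch_eq_endpt_of_mem_zone ((hmem s hs).1 i α hi)
    refine ⟨_, hinc, hpres, fun s hs => ⟨_, fun j => ?_, rfl⟩⟩
    obtain ⟨-, w, hw, hfree⟩ := hmem s hs
    obtain ⟨f, hf⟩ := hφ.exists_index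
    have hwz : w j = z s j := (hfree _ j ((hf _ j).2 rfl)).symm.trans (hz s _ j ((hf _ j).2 rfl))
    exact stretch_ne_endpt_of_mem_zone (hwz ▸ hw j)
  · intro a m b ham hmb hleft hright hV
    obtain ⟨v, hv, hpv, hvψ⟩ := hleft (hV.mono_left (Icc_subset_Icc_right hmb))
    obtain ⟨w, hw, hpw, hwψ⟩ := hright (hV.mono_left (Icc_subset_Icc_left ham))
    have hm := right_mem_Icc.2 ham
    have hm' := left_mem_Icc.2 hmb
    refine ⟨_, hv.ite hw (hψ.injOn_pt_openFace (hvψ hm) (hwψ hm')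
      ((hpv m hm).symm.trans (hpw m hm'))), hpv.ite hpw, fun s hs => ?_⟩
    dsimp only
    split_ifs with hsm
    · exact hvψ ⟨hs.1, hsm⟩
    · exact hwψ ⟨(not_le.1 hsm).le, hs.2⟩

end Lifting

section Tracking

variable {l : ℕ} {d : X.cube l} {p : C(I, X.Realization)} {t : ℝ≥0} {a b s s' m : I}
  {x x' x'' : Fin l → I}

/-- The stretching by `t` moves `q` to the same point as `[d; w]`. -/
def IsPointShadow (d : X.cube l) (t : ℝ≥0) (q : X.Realization) (w : Fin l → I) : Prop :=
  stretchFlow X t q = pt d (stretchVec t w)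

theorem IsPointShadow.mono {t' : ℝ≥0} {q : X.Realization} (h : IsPointShadow d t q x)
    (ht : t ≤ t') : IsPointShadow d t' q x := by
  obtain ⟨r, rfl⟩ := exists_add_of_le ht
  rw [IsPointShadow, add_comm, Flow.map_add, h, stretchFlow_pt, stretchVec_add]

theorem exists_isFace_mem_core (d : X.cube l) (x : Fin l → I) (ht : 0 < t) :
    ∃ (k : ℕ) (e : X.cube k) (ψ : Fin l → Bool ⊕ Fin k) (z : Fin k → I) (t₀ : ℝ≥0),
      IsFace e d ψ ∧ x = faceMap ψ z ∧ 0 < t₀ ∧ t₀ ≤ t ∧ z ∈ core t₀ k := by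
  obtain ⟨k, e, ψ, z, hψ, rfl, hz⟩ := exists_carrier d x
  obtain ⟨t₀, ⟨ht₀, ht₀t⟩, hzt⟩ := (Eventually.and (Ioc_mem_nhdsGT ht)
    (nhdsWithin_le_nhds (eventually_mem_core hz))).exists
  exact ⟨k, e, ψ, z, t₀, hψ, rfl, ht₀, ht₀t, hzt⟩

theorem eventually_exists_isPointShadow (ht : 0 < t) {O : Set (Fin l → I)} (hO : O ∈ 𝓝 x) :
    ∀ᶠ q in 𝓝 (pt d x), ∃ w ∈ O, IsPointShadow d t q w := by
  obtain ⟨k, e, ψ, z, t₀, hψ, rfl, ht₀, ht₀t, hz⟩ := exists_isFace_mem_core d x ht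
  obtain ⟨O', hO'O, hO', hzO'⟩ := mem_nhds_iff.1 ((continuous_faceMap ψ).continuousAt hO)
  rw [hψ.pt_eq]
  filter_upwards [(isOpen_stretchNhd ht₀ ((isOpen_core t₀ k).inter hO') inter_subset_left).mem_nhds
    (pt_mem_stretchNhd (e := e) ⟨hz, hzO'⟩)] with q hq
  obtain ⟨w, hw, hqw⟩ := exists_stretchFlow_eq_of_mem_stretchNhd hq
  refine ⟨faceMap ψ w, hO'O hw.2, IsPointShadow.mono ?_ ht₀t⟩
  rw [IsPointShadow, stretchVec_faceMap, hψ.pt_eq, hqw]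

/-- After stretching by `t`, all d-paths `p'` near `p` run in `d` over `[s,s']`, with end points
prescribed by the shadows of `p' s` and `p' s'` near `x` and `x'`. -/
def TracksIn (p : C(I, X.Realization)) (d : X.cube l) (t : ℝ≥0) (s s' : I) (x x' : Fin l → I) :
    Prop :=
  ∃ t₀ > 0, ∃ O ∈ 𝓝 x, ∃ O' ∈ 𝓝 x', ∀ᶠ p' in 𝓝 p, IsDPath p' → ∀ w ∈ O, ∀ w' ∈ O',
    IsPointShadow d t₀ (p' s) w → IsPointShadow d t₀ (p' s') w' →
      RunsIn (pathFlow X t p') d s s' (stretchVec t w) (stretchVec t w')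

theorem TracksIn.trans (hsm : s ≤ m) (hms : m ≤ s') (hpm : p m = pt d x')
    (h : TracksIn p d t s m x x') (h' : TracksIn p d t m s' x' x'') :
    TracksIn p d t s s' x x'' := by
  obtain ⟨t₁, ht₁, O, hO, O₁, hO₁, h⟩ := h
  obtain ⟨t₂, ht₂, O₂, hO₂, O', hO', h'⟩ := h'
  have hmid : ∀ᶠ p' in 𝓝 p, ∃ w ∈ O₁ ∩ O₂, IsPointShadow d (min t₁ t₂) (p' m) w :=
    (ContinuousEvalConst.continuous_eval_const m).continuousAt.eventually
      (hpm ▸ eventually_exists_isPointShadow (lt_min ht₁ ht₂) (inter_mem hO₁ hO₂))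
  refine ⟨min t₁ t₂, lt_min ht₁ ht₂, O, hO, O', hO', ?_⟩
  filter_upwards [h, h', hmid] with p' h h' ⟨v, hv, hmv⟩ hp' w hw w' hw' hsw hsw'
  exact (h hp' w hw v hv.1 (hsw.mono (min_le_left _ _)) (hmv.mono (min_le_left _ _))).trans hsm hms
    (h' hp' v hv.2 w' hw' (hmv.mono (min_le_right _ _)) (hsw'.mono (min_le_right _ _)))

theorem exists_nhds_tracksIn (d : X.cube l) (x : Fin l → I) (ht : 0 < t) :
    ∃ O ∈ 𝓝 x, ∃ V ∈ 𝓝 (pt d x), ∀ (p : C(I, X.Realization)) (s s' : I), s ≤ s' →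
      MapsTo p (Icc s s') V → ∀ y ∈ O, ∀ y' ∈ O, TracksIn p d t s s' y y' := by
  obtain ⟨k, e, ψ, z, t₀, hψ, rfl, ht₀, ht₀t, hz⟩ := exists_isFace_mem_core d x ht
  obtain ⟨r, rfl⟩ := exists_add_of_le ht₀t
  have hO : IsOpen (faceBasin t₀ ψ) :=
    hψ.isOpen_faceNhd (fun α => isOpen_zone t₀ (some α)) (isOpen_core t₀ k)
  have hV : IsOpen (stretchNhd e t₀ (core t₀ k)) :=
    isOpen_stretchNhd ht₀ (isOpen_core t₀ k) subset_rfl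
  refine ⟨faceBasin t₀ ψ, hO.mem_nhds (faceMap_mem_faceBasin ht₀ hz), _,
    hV.mem_nhds (hψ.pt_eq z ▸ pt_mem_stretchNhd hz), fun p s s' hss' hp y hy y' hy' =>
    ⟨t₀, ht₀, _, hO.mem_nhds hy, _, hO.mem_nhds hy', ?_⟩⟩
  filter_upwards [ContinuousMap.eventually_mapsTo isCompact_Icc hV hp]
    with p' hmaps hp' w hw w' hw' hsw hsw'
  obtain ⟨v, hv, hpv, hvψ⟩ := hp'.exists_lift hψ ht₀ hss' hmaps
  have hend : ∀ τ ∈ Icc s s', ∀ w ∈ faceBasin t₀ ψ, IsPointShadow d t₀ (p' τ) w →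
      v τ = stretchVec t₀ w := fun τ hτ w hw hτw =>
    hψ.injOn_pt_openFace (hvψ hτ) (stretchVec_mem_openFace hw) ((hpv τ hτ).symm.trans hτw)
  have hrun : RunsIn (pathFlow X t₀ p') d s s' (stretchVec t₀ w) (stretchVec t₀ w') :=
    ⟨v, hv, hpv, hend s (left_mem_Icc.2 hss') w hw hsw, hend s' (right_mem_Icc.2 hss') w' hw' hsw'⟩
  simpa only [add_comm t₀ r, Flow.map_add, stretchVec_add] using hrun.pathFlow r

theorem interval_induction_of_nhds {Q : I → I → Prop} (hab : a ≤ b)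
    (nhds : ∀ u ∈ Icc a b, ∃ W ∈ 𝓝 u, ∀ s ∈ Icc a b, ∀ s' ∈ Icc a b, s ≤ s' → Icc s s' ⊆ W →
      Q s s')
    (trans : ∀ s ∈ Icc a b, ∀ m ∈ Icc a b, ∀ s' ∈ Icc a b, s ≤ m → m ≤ s' → Q s m → Q m s' →
      Q s s') : Q a b := by
  choose! W hW hQ using nhds
  let c : Option (Icc a b) → Set I := fun o => o.elim (Icc a b)ᶜ fun u => interior (W u)
  have hc : ∀ o, IsOpen (c o) := fun o => by
    cases o with
    | none => exact isClosed_Icc.isOpen_compl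
    | some u => exact isOpen_interior
  have hcover : univ ⊆ ⋃ o, c o := fun s _ => by
    by_cases hs : s ∈ Icc a b
    · exact mem_iUnion.2 ⟨some ⟨s, hs⟩, mem_interior_iff_mem_nhds.2 (hW s hs)⟩
    · exact mem_iUnion.2 ⟨none, hs⟩
  obtain ⟨t, ht0, htm, ⟨n, hn⟩, htc⟩ := exists_monotone_Icc_subset_open_cover_unitInterval hc hcover
  have hsub : IsSubdivision (l := n) fun k => t k :=
    ⟨fun _ _ h => htm h, ht0, hn n le_rfl⟩
  refine hsub.interval_induction (Q := fun s s' => s ∈ Icc a b → s' ∈ Icc a b → Q s s')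
    (fun k s s' hss' hs hs' hsab hsab' => ?_)
    (fun s m s' hsm hms' h h' hs hs' => ?_) hab (left_mem_Icc.2 hab) (right_mem_Icc.2 hab)
  · obtain ⟨_ | u, hu⟩ := htc k
    · exact absurd hsab (hu ⟨hs, hss'.trans hs'⟩)
    · exact hQ u u.2 s hsab s' hsab' hss'
        ((Icc_subset_Icc hs hs').trans (hu.trans interior_subset))
  · have hm : m ∈ Icc a b := ⟨hs.1.trans hsm, hms'.trans hs'.2⟩
    exact trans s hs m hm s' hs' hsm hms' (h hs hm) (h' hm hs')

theorem Increasing.tracksIn {β : I → Fin l → I} (hβ : Increasing β a b)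
    (hp : Presents p a b d β) (hab : a ≤ b) (ht : 0 < t) :
    TracksIn p d t a b (β a) (β b) := by
  refine interval_induction_of_nhds (Q := fun s s' => TracksIn p d t s s' (β s) (β s')) hab
    (fun u hu => ?_) fun s _ m hm s' _ hsm hms' h h' => h.trans hsm hms' (hp m hm) h'
  obtain ⟨O, hO, V, hV, htrack⟩ := exists_nhds_tracksIn d (β u) ht
  refine ⟨_, eventually_nhdsWithin_iff.1 (((hβ.1 u hu).eventually_mem hO).and
    (p.continuous.continuousWithinAt.eventually_mem (hp u hu ▸ hV))),
    fun s hs s' hs' hss' hW => htrack p s s' hss' (fun τ hτ => ?_) _ ?_ _ ?_⟩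
  · exact (hW hτ ⟨hs.1.trans hτ.1, hτ.2.trans hs'.2⟩).2
  · exact (hW (left_mem_Icc.2 hss') hs).1
  · exact (hW (right_mem_Icc.2 hss') hs').1

theorem eventually_stretchVec_eq_endpt (ht : 0 < t) (α : Bool) :
    ∀ᶠ w in 𝓝 (fun _ : Fin l => endpt α), stretchVec t w = fun _ => endpt α := by
  have hzone : ∀ᶠ w in 𝓝 (fun _ : Fin l => endpt α), ∀ i, w i ∈ zone t (some α) :=
    eventually_all.2 fun i => (continuous_apply i).continuousAt.eventually_mem
      ((isOpen_zone t _).mem_nhds (endpt_mem_zone ht α))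
  exact hzone.mono fun w hw => funext fun i => stretch_eq_endpt_of_mem_zone (hw i)

theorem eventually_runsIn (hab : a ≤ b) (h : RunsIn p d a b 0 1) (ht : 0 < t) :
    ∀ᶠ p' in 𝓝 p, IsDPath p' → RunsIn (pathFlow X t p') d a b 0 1 := by
  obtain ⟨β, hβ, hp, hβa, hβb⟩ := h
  obtain ⟨t₀, ht₀, O, hO, O', hO', htrack⟩ := hβ.tracksIn hp hab ht
  have hshadow : ∀ {s : I}, p s = pt d (β s) → ∀ {α : Bool}, β s = (fun _ => endpt α) →
      ∀ {O : Set (Fin l → I)}, O ∈ 𝓝 (β s) → ∀ᶠ p' in 𝓝 p, ∃ w ∈ O,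
        stretchVec t w = (fun _ => endpt α) ∧ IsPointShadow d t₀ (p' s) w := by
    intro s hps α hα O hO
    have hw := inter_mem hO (hα ▸ eventually_stretchVec_eq_endpt ht α)
    filter_upwards [(ContinuousEvalConst.continuous_eval_const s).continuousAt.eventually
      (hps ▸ eventually_exists_isPointShadow ht₀ hw)] with p' ⟨w, ⟨hwO, hwα⟩, hws⟩
    exact ⟨w, hwO, hwα.trans hα, hws⟩
  filter_upwards [htrack, hshadow (hp a (left_mem_Icc.2 hab)) (α := false) hβa hO,
    hshadow (hp b (right_mem_Icc.2 hab)) (α := true) hβb hO']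
    with p' htrack ⟨w, hw, hw0, haw⟩ ⟨w', hw', hw1, hbw'⟩ hp'
  have hrun := htrack hp' w hw w' hw' haw hbw'
  rwa [hw0, hw1] at hrun

end Tracking

section Invariance

variable {k m n : ℕ} {p : C(I, X.Realization)} {d : X.cube m} {a b : I}

theorem IsDPath.pathFlow (h : IsDPath p) (t : ℝ≥0) : IsDPath (pathFlow X t p) := by
  obtain ⟨l, s, hs, h⟩ := h
  refine ⟨l, s, hs, fun i => ?_⟩
  obtain ⟨n, c, β, hβ, hp⟩ := h i
  exact ⟨n, c, _, hβ.stretchVec t, hp.stretchVec t⟩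

theorem StrictlyIncreasing.stretchVec {β : I → Fin n → I} (h : StrictlyIncreasing β a b)
    (t : ℝ≥0) : StrictlyIncreasing (fun s => stretchVec t (β s)) a b := by
  refine ⟨h.1.stretchVec t, fun i s hs s' hs' heq => ?_⟩
  by_contra! ⟨hss', h0, h1⟩
  have heq : stretch t (β s i) = stretch t (β s' i) := heq
  have hne : ∀ α, stretch t (β s i) ≠ endpt α := Bool.forall_bool.2 ⟨h0, h1⟩
  have hβ : β s i = β s' i := stretch_injOn t hne (fun α => heq ▸ hne α) heq
  rcases h.2 i s hs s' hs' hβ with h | h | h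
  · exact hss' h
  · exact hne false (h ▸ stretch_endpt t false)
  · exact hne true (h ▸ stretch_endpt t true)

theorem IsStrict.pathFlow (h : IsStrict p) (t : ℝ≥0) : IsStrict (pathFlow X t p) := by
  obtain ⟨l, s, hs, h⟩ := h
  refine ⟨l, s, hs, fun i => ?_⟩
  obtain ⟨n, c, β, hβ, hp⟩ := h i
  exact ⟨n, c, _, hβ.stretchVec t, hp.stretchVec t⟩

theorem IsTame.pathFlow (h : IsTame p) (t : ℝ≥0) : IsTame (pathFlow X t p) := by
  obtain ⟨l, s, hs, hv, h⟩ := h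
  refine ⟨l, s, hs, fun i => ?_, fun i => ?_⟩
  · obtain ⟨v, hv⟩ := hv i
    exact ⟨v, by rw [pathFlow_apply, hv, stretchFlow_vpt]⟩
  · obtain ⟨n, c, β, hβ, hp⟩ := h i
    exact ⟨n, c, _, hβ.stretchVec t, hp.stretchVec t⟩

theorem stretchVec_mem_faceCollar {φ : Fin n → Bool ⊕ Fin k} {y : Fin n → I}
    (h : y ∈ faceCollar φ) (t : ℝ≥0) : stretchVec t y ∈ faceCollar φ := fun i =>
  ⟨fun hi => stretch_lt_half_iff.2 ((h i).1 hi), fun hi => half_lt_stretch_iff.2 ((h i).2 hi)⟩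

theorem stretchFlow_mem_collar {q : X.Realization} (h : q ∈ collar d) (t : ℝ≥0) :
    stretchFlow X t q ∈ collar d := by
  obtain ⟨n, k, c, e, φ, ψ, hφ, hψ, y, hy, rfl⟩ := h
  exact ⟨n, k, c, e, φ, ψ, hφ, hψ, _, stretchVec_mem_faceCollar hy t, stretchFlow_pt t c y⟩

theorem IsShadow.pathFlow {r : I → Fin m → I} (h : IsShadow p d a b r) (t : ℝ≥0) :
    IsShadow (pathFlow X t p) d a b (fun s => stretchVec t (r s)) := by
  obtain ⟨n, k, c, e, φ, ψ, β, hφ, hψ, hβ, hp, hr⟩ := h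
  refine ⟨n, k, c, e, φ, ψ, _, hφ, hψ, hβ.stretchVec t, hp.stretchVec t, fun s hs => ?_⟩
  obtain ⟨hmem, z, hz, hrz⟩ := hr s hs
  refine ⟨stretchVec_mem_faceCollar hmem t, stretchVec t z,
    fun i j hij => congrArg (stretch t) (hz i j hij), ?_⟩
  exact (congrArg (stretchVec t) hrz).trans (stretchVec_faceMap t ψ z)

theorem RunsThrough.pathFlow (h : RunsThrough p d a b) (t : ℝ≥0) :
    RunsThrough (pathFlow X t p) d a b := by
  obtain ⟨l, s, r, hs, ha, hb, hsh, hside, h0, h1⟩ := h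
  refine ⟨l, s, fun k τ => stretchVec t (r k τ), hs, ha, hb, fun k => (hsh k).pathFlow t,
    fun k i => ?_, fun i => stretch_lt_half_iff.2 (h0 i), fun i => half_lt_stretch_iff.2 (h1 i)⟩
  simpa only [stretchVec, stretch_lt_half_iff, half_lt_stretch_iff] using hside k i

theorem isInvariant_strictPaths (x y : X.cube 0) : IsInvariant (pathFlow X) (strictPaths x y) :=
  fun t p h => ⟨by rw [pathFlow_apply, h.1, stretchFlow_vpt],
    by rw [pathFlow_apply, h.2.1, stretchFlow_vpt], h.2.2.pathFlow t⟩

theorem isInvariant_strictTamePaths (x y : X.cube 0) :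
    IsInvariant (pathFlow X) (strictTamePaths x y) :=
  fun t p h => ⟨by rw [pathFlow_apply, h.1, stretchFlow_vpt],
    by rw [pathFlow_apply, h.2.1, stretchFlow_vpt], h.2.2.1.pathFlow t, h.2.2.2.pathFlow t⟩

end Invariance

section Absorption

variable {m : ℕ} {p : C(I, X.Realization)} {d : X.cube m} {a b : I}

theorem SameSide.eventually_stretchVec_eq {x y : Fin m → I} (h : SameSide x y) :
    ∀ᶠ t in atTop, stretchVec t x = stretchVec t y := by
  have hcoord : ∀ i, ∀ᶠ t in atTop, stretch t (x i) = stretch t (y i) := by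
    intro i
    obtain ⟨hlow, hup⟩ := h i
    rcases lt_trichotomy (x i : ℝ) (1 / 2) with hx | hx | hx
    · filter_upwards [eventually_stretch_eq_zero hx, eventually_stretch_eq_zero (hlow.1 hx)]
        with t hxt hyt
      rw [hxt, hyt]
    · have hy : (y i : ℝ) = 1 / 2 :=
        le_antisymm (not_lt.1 fun h => (hup.2 h).ne' hx) (not_lt.1 fun h => (hlow.2 h).ne hx)
      rw [Subtype.ext (hx.trans hy.symm)]
      exact .of_forall fun _ => rfl
    · filter_upwards [eventually_stretch_eq_one hx, eventually_stretch_eq_one (hup.1 hx)]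
        with t hxt hyt
      rw [hxt, hyt]
  exact (eventually_all.2 hcoord).mono fun t ht => funext ht

theorem Increasing.eventually_stretch_eq_endpt {n k : ℕ} {φ : Fin n → Bool ⊕ Fin k}
    {β : I → Fin n → I} (hβ : Increasing β a b) (hab : a ≤ b)
    (hmem : ∀ s ∈ Icc a b, β s ∈ faceCollar φ) :
    ∀ᶠ t in atTop, ∀ i α, φ i = Sum.inl α → ∀ s ∈ Icc a b, stretch t (β s i) = endpt α := by
  have ha := left_mem_Icc.2 hab
  have hb := right_mem_Icc.2 hab
  refine eventually_all.2 fun i => eventually_all.2 fun α =>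
    eventually_imp_distrib_left.2 fun hi => ?_
  cases α with
  | false =>
    filter_upwards [eventually_stretch_eq_zero ((hmem b hb i).1 hi)] with t ht s hs
    exact le_antisymm ((stretch_monotone t (hβ.2 hs hb hs.2 i)).trans_eq ht) nonneg'
  | true =>
    filter_upwards [eventually_stretch_eq_one ((hmem a ha i).2 hi)] with t ht s hs
    exact le_antisymm le_one' (ht.symm.trans_le (stretch_monotone t (hβ.2 ha hs hs.1 i)))

theorem IsShadow.eventually_runsIn (hab : a ≤ b) {r : I → Fin m → I} (h : IsShadow p d a b r) :
    ∀ᶠ t in atTop,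
      RunsIn (PrecubicalSet.pathFlow X t p) d a b (stretchVec t (r a)) (stretchVec t (r b)) := by
  obtain ⟨n, k, c, e, φ, ψ, β, hφ, hψ, hβ, hp, hr⟩ := h
  filter_upwards [hβ.eventually_stretch_eq_endpt hab fun s hs => (hr s hs).1] with t hfix
  obtain ⟨z, hz, hinc, hpres⟩ := hβ.exists_lift hp hφ hψ fun s hs i α hi => hfix i α hi s hs
  have hrz : ∀ s ∈ Icc a b, faceMap ψ (stretchVec t (z s)) = stretchVec t (r s) := by
    intro s hs
    obtain ⟨-, z', hz', hr'⟩ := hr s hs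
    obtain ⟨f, hf⟩ := hφ.exists_index
    have hzz' : z s = z' := funext fun j =>
      (hz s _ j ((hf _ j).2 rfl)).symm.trans (hz' _ j ((hf _ j).2 rfl))
    rw [hr', stretchVec_faceMap, hzz']
  exact ⟨_, hinc, hpres, hrz a (left_mem_Icc.2 hab), hrz b (right_mem_Icc.2 hab)⟩

theorem RunsThrough.eventually_runsIn (h : RunsThrough p d a b) :
    ∀ᶠ t in atTop, RunsIn (PrecubicalSet.pathFlow X t p) d a b 0 1 := by
  obtain ⟨l, s, r, hs, rfl, rfl, hsh, hside, h0, h1⟩ := h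
  filter_upwards [eventually_all.2 fun k => (hsh k).eventually_runsIn (hs (Fin.castSucc_le_succ _)),
    eventually_all.2 fun k => (hside k).eventually_stretchVec_eq,
    eventually_all.2 fun i => eventually_stretch_eq_zero (h0 i),
    eventually_all.2 fun i => eventually_stretch_eq_one (h1 i)] with t hrun hglue hstart hend
  have hinit : ∀ k : Fin (l + 1), RunsIn (PrecubicalSet.pathFlow X t p) d (s 0) (s k.succ)
      (stretchVec t (r 0 (s 0))) (stretchVec t (r k (s k.succ))) := by
    intro k
    induction k using Fin.induction with
    | zero => simpa using hrun 0
    | succ k ih =>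
      rw [Fin.succ_castSucc, hglue k] at ih
      exact ih.trans (hs (Fin.zero_le _)) (hs (Fin.castSucc_le_succ _)) (hrun k.succ)
  have hall := hinit (Fin.last l)
  rwa [Fin.succ_last, show stretchVec t (r 0 (s 0)) = 0 from funext hstart,
    show stretchVec t (r (Fin.last l) (s (Fin.last (l + 1)))) = 1 from funext hend] at hall

theorem RunsIn.runsThrough (hab : a ≤ b) (h : RunsIn p d a b 0 1) : RunsThrough p d a b := by
  obtain ⟨β, hβ, hp, hβa, hβb⟩ := h
  have hshadow : IsShadow p d a b β :=
    ⟨m, m, d, d, Sum.inr, Sum.inr, β, .refl d, .refl d, hβ, hp, fun s _ =>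
      ⟨fun i => by simp, β s, fun i j hij => congrArg (β s) (Sum.inr.inj hij), rfl⟩⟩
  refine ⟨0, ![a, b], fun _ => β, ?_, rfl, rfl, fun k => ?_, fun k => k.elim0, fun i => ?_,
    fun i => ?_⟩
  · exact Fin.monotone_iff_le_succ.2 fun i => by simpa [Subsingleton.elim i 0] using hab
  · simpa [Subsingleton.elim (α := Fin 1) k 0] using hshadow
  · simp [hβa]
  · norm_num [hβb]

theorem pt_mem_collar (d : X.cube m) (x : Fin m → I) : pt d x ∈ collar d :=
  ⟨m, m, d, d, Sum.inr, Sum.inr, .refl d, .refl d, x, fun i => by simp, rfl⟩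

end Absorption

namespace CubeChain

variable {x y : X.cube 0} {c : CubeChain X x y} {p : C(I, X.Realization)}

theorem mem_tamePathsIn_iff_runsIn : p ∈ c.tamePathsIn ↔
    ∃ t : Fin (c.n + 1) → I, IsSubdivision t ∧
      ∀ i : Fin c.n, RunsIn p (c.cube i) (t i.castSucc) (t i.succ) 0 1 := Iff.rfl

theorem isInvariant_tamePathsIn : IsInvariant (pathFlow X) c.tamePathsIn := by
  rintro t p ⟨s, hs, h⟩
  refine mem_tamePathsIn_iff_runsIn.2 ⟨s, hs, fun i => ?_⟩
  have hrun := RunsIn.pathFlow (h i) t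
  exact (stretchVec_endpt t false ▸ stretchVec_endpt t true ▸ hrun :)

theorem isInvariant_pathsInCollar : IsInvariant (pathFlow X) c.pathsInCollar := by
  rintro t p ⟨hd, s, hs, hstar, h⟩
  exact ⟨hd.pathFlow t, s, hs, fun i => stretchFlow_mem_collar (hstar i) t, fun i =>
    ⟨fun s hs => stretchFlow_mem_collar ((h i).1 s hs) t, (h i).2.pathFlow t⟩⟩

theorem eventually_pathFlow_mem_tamePathsIn (h : p ∈ c.tamePathsIn) {t : ℝ≥0} (ht : 0 < t) :
    ∀ᶠ p' in 𝓝 p, IsDPath p' → pathFlow X t p' ∈ c.tamePathsIn := by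
  obtain ⟨s, hs, h⟩ := h
  filter_upwards [eventually_all.2 fun i =>
    eventually_runsIn (hs.1 (Fin.castSucc_le_succ i)) (h i) ht] with p' hrun hp'
  exact ⟨s, hs, fun i => hrun i hp'⟩

theorem exists_pathFlow_mem_tamePathsIn (h : p ∈ c.pathsInCollar) :
    ∃ t, pathFlow X t p ∈ c.tamePathsIn := by
  obtain ⟨-, s, hs, -, h⟩ := h
  obtain ⟨t, ht⟩ := (eventually_all.2 fun i => (h i).2.eventually_runsIn).exists
  exact ⟨t, s, hs, ht⟩

theorem exists_succ_eq_last (c : CubeChain X x y) : ∃ i : Fin c.n, i.succ = Fin.last c.n :=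
  haveI := NeZero.of_pos c.n_pos
  Fin.exists_succ_eq.2 Fin.last_pos'.ne'

theorem apply_eq_vertex {t : Fin (c.n + 1) → I} (ht : IsSubdivision t)
    (h : ∀ i : Fin c.n, RunsIn p (c.cube i) (t i.castSucc) (t i.succ) 0 1) (i : Fin (c.n + 1)) :
    p (t i) = vpt (c.vertex i) := by
  have hle : ∀ i : Fin c.n, t i.castSucc ≤ t i.succ := fun i => ht.1 (Fin.castSucc_le_succ i)
  have hboth : ∀ i : Fin c.n, p (t i.castSucc) = vpt (c.vertex i.castSucc) ∧
      p (t i.succ) = vpt (c.vertex i.succ) := by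
    intro i
    obtain ⟨β, -, hp, h0, h1⟩ := h i
    rw [hp _ (left_mem_Icc.2 (hle i)), hp _ (right_mem_Icc.2 (hle i)), h0, h1, ← c.source_eq,
      ← c.target_eq, ← pt_corner, ← pt_corner]
    exact ⟨rfl, rfl⟩
  induction i using Fin.lastCases with
  | cast i => exact (hboth i).1
  | last =>
    obtain ⟨i, hi⟩ := c.exists_succ_eq_last
    exact hi ▸ (hboth i).2

variable (c) in
theorem strictTameIn_subset_strictTameInCollar : c.strictTameIn ⊆ c.strictTameInCollar := by
  rintro p ⟨⟨t, ht, h⟩, h0, h1, hs⟩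
  have hv := apply_eq_vertex ht h
  have hmem : ∀ i, ∀ s ∈ Icc (t i.castSucc) (t i.succ), p s ∈ collar (c.cube i) := by
    intro i s hs
    obtain ⟨β, -, hp, -⟩ := h i
    exact hp s hs ▸ pt_mem_collar _ _
  refine ⟨⟨hs.isDPath, t, ht, fun i => hv i ▸ pt_mem_collar _ _, fun i =>
    ⟨hmem i, RunsIn.runsThrough (ht.1 (Fin.castSucc_le_succ i)) (h i)⟩⟩,
    h0, h1, hs, c.n, t, ht, fun i => ⟨_, hv i⟩, fun i => ?_⟩
  obtain ⟨β, hβ, hp, -⟩ := h i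
  exact ⟨_, _, β, hβ, hp⟩

variable (c) in
theorem strictTameInCollar_subset_strictInCollar : c.strictTameInCollar ⊆ c.strictInCollar :=
  fun _ h => ⟨h.1, h.2.1, h.2.2.1, h.2.2.2.1⟩

end CubeChain

section CoordSum

variable {M : Type*} [AddCommMonoid M]

/-- The sum of the values of `f` at the coordinates of a point of the realization. It depends only
on the point because `f` vanishes at `0` and `1`. -/
def coordSum (f : I → M) (hf : ∀ α, f (endpt α) = 0) : X.Realization → M :=
  Quot.lift (fun q => ∑ i, f (q.2 i)) (by
    rintro _ _ ⟨c, α, i, x⟩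
    simp [Fin.sum_univ_succAbove _ i, hf])

theorem coordSum_pt (f : I → M) (hf : ∀ α, f (endpt α) = 0) {n : ℕ} (c : X.cube n)
    (x : Fin n → I) : coordSum f hf (pt c x) = ∑ i, f (x i) := rfl

/-- The indicator function of the midpoint of the unit interval. -/
noncomputable def halfIndicator : I → ℕ := indicator {x | (x : ℝ) = 1 / 2} 1

theorem halfIndicator_endpt (α : Bool) : halfIndicator (endpt α) = 0 :=
  indicator_of_notMem (by cases α <;> norm_num [endpt]) _

theorem halfIndicator_of_eq {x : I} (h : (x : ℝ) = 1 / 2) : halfIndicator x = 1 :=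
  indicator_of_mem (s := {x : I | (x : ℝ) = 1 / 2}) h _

theorem halfIndicator_of_ne {x : I} (h : (x : ℝ) ≠ 1 / 2) : halfIndicator x = 0 :=
  indicator_of_notMem (s := {x : I | (x : ℝ) = 1 / 2}) h _

/-- The number of coordinates of a point of the realization that are equal to `1/2`. -/
noncomputable def numHalves : X.Realization → ℕ := coordSum halfIndicator halfIndicator_endpt

theorem numHalves_stretchFlow (t : ℝ≥0) (q : X.Realization) :
    numHalves (stretchFlow X t q) = numHalves q := by
  obtain ⟨n, c, x, rfl⟩ := exists_eq_pt q
  rw [stretchFlow_pt, numHalves, coordSum_pt, coordSum_pt]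
  refine Finset.sum_congr rfl fun i _ => ?_
  simp only [halfIndicator, indicator, mem_ofPred_eq, stretchVec, stretch_eq_half_iff,
    Pi.one_apply]

theorem IsStrict.finite_numHalves_ne_zero {p : C(I, X.Realization)} (h : IsStrict p) :
    {s | numHalves (p s) ≠ 0}.Finite := by
  obtain ⟨l, t, ht, h⟩ := h
  have hpiece : ∀ k : Fin l,
      {s | s ∈ Icc (t k.castSucc) (t k.succ) ∧ numHalves (p s) ≠ 0}.Finite := by
    intro k
    obtain ⟨n, c, β, hβ, hp⟩ := h k
    have honce : ∀ i,
        {s | s ∈ Icc (t k.castSucc) (t k.succ) ∧ (β s i : ℝ) = 1 / 2}.Subsingleton := by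
      rintro i s ⟨hs, hsi⟩ s' ⟨hs', hsi'⟩
      rcases hβ.2 i s hs s' hs' (Subtype.ext (hsi.trans hsi'.symm)) with heq | h0 | h1
      · exact heq
      · norm_num [h0] at hsi
      · norm_num [h1] at hsi
    refine (finite_iUnion fun i => (honce i).finite).subset ?_
    rintro s ⟨hs, hne⟩
    rw [hp s hs, numHalves, coordSum_pt] at hne
    obtain ⟨i, -, hi⟩ := Finset.exists_ne_zero_of_sum_ne_zero hne
    exact mem_iUnion.2 ⟨i, hs, not_imp_comm.1 halfIndicator_of_ne hi⟩
  refine (finite_iUnion hpiece).subset fun s hs => ?_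
  obtain ⟨k, hk⟩ := ht.exists_mem_Icc s
  exact mem_iUnion.2 ⟨k, hk, hs⟩

end CoordSum

namespace CubeChain

variable {x y : X.cube 0}

/-- The coordinates of all cubes of a chain, i.e. those of the product of its cubes. -/
abbrev Coord (c : CubeChain X x y) : Type := Σ i : Fin c.n, Fin (c.dim i)

/-- `w` lies in the wedge of the cubes of the chain, embedded into their product with the earlier
cubes at their target and the later cubes at their source, and it represents `q`. -/
def Represents (c : CubeChain X x y) (w : c.Coord → I) (q : X.Realization) : Prop :=
  ∃ i, (∀ a : c.Coord, a.1 < i → w a = 1) ∧ (∀ a : c.Coord, i < a.1 → w a = 0) ∧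
    q = pt (c.cube i) (fun j => w ⟨i, j⟩)

/-- `B` is a monotone, not necessarily continuous lift of `p` to the wedge of the cubes of the chain
which leads from the first to the last vertex. -/
structure IsLift (c : CubeChain X x y) (B : I → c.Coord → I) (p : C(I, X.Realization)) :
    Prop where
  monotone : Monotone B
  zero : B 0 = 0
  one : B 1 = 1
  represents : ∀ s, c.Represents (B s) (p s)

variable {c : CubeChain X x y}

theorem Represents.coordSum_eq {M : Type*} [AddCommMonoid M] (f : I → M)
    (hf : ∀ α, f (endpt α) = 0) {w : c.Coord → I} {q : X.Realization} (hw : c.Represents w q) :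
    coordSum f hf q = ∑ a, f (w a) := by
  obtain ⟨i, h1, h0, rfl⟩ := hw
  rw [coordSum_pt, Fintype.sum_sigma, Finset.sum_eq_single_of_mem i (Finset.mem_univ i)]
  intro i' _ hne
  refine Finset.sum_eq_zero fun j _ => ?_
  rcases hne.lt_or_gt with hlt | hgt
  · exact (congrArg f (h1 ⟨i', j⟩ hlt)).trans (hf true)
  · exact (congrArg f (h0 ⟨i', j⟩ hgt)).trans (hf false)

theorem Represents.eq_of_le_of_mem {v w : c.Coord → I} {q : X.Realization}
    (hv : c.Represents v q) (hw : c.Represents w q) (hvw : v ≤ w) {S : Set I} (hS0 : 0 ∉ S)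
    (hS1 : 1 ∈ S) (hS : ∀ a, w a ∈ S → v a ∈ S) : v = w := by
  -- The coordinate sum of `x - 1_S x` is well defined on `|X|`, unlike that of `x`.
  let f : I → ℝ := fun x => x - S.indicator 1 x
  have hf : ∀ α, f (endpt α) = 0 := Bool.forall_bool.2 ⟨by simp [f, endpt, hS0], by
    simp [f, endpt, hS1]⟩
  have hdiff : ∀ a, (w a : ℝ) - v a ≤ f (w a) - f (v a) := by
    intro a
    have hle : S.indicator (1 : I → ℝ) (w a) ≤ S.indicator 1 (v a) := by
      by_cases ha : w a ∈ S
      · simp [ha, hS a ha]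
      · exact (indicator_of_notMem ha _).trans_le (indicator_nonneg (fun _ _ => zero_le_one) _)
    simp only [f]
    linarith
  have hmono : ∀ a, (v a : ℝ) ≤ w a := hvw
  have hsum := (hv.coordSum_eq f hf).symm.trans (hw.coordSum_eq f hf)
  rw [Finset.sum_eq_sum_iff_of_le fun a _ => by linarith [hdiff a, hmono a]] at hsum
  exact funext fun a => Subtype.ext (by linarith [hdiff a, hmono a, hsum a (Finset.mem_univ a)])

theorem pt_one_eq_pt_zero {i i' : Fin c.n} (h : i.succ = i'.castSucc) :
    pt (c.cube i) 1 = pt (c.cube i') 0 := by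
  have hvertex : X.corner true (c.cube i) = X.corner false (c.cube i') := by
    rw [c.target_eq, h, c.source_eq]
  exact (pt_corner true (c.cube i)).trans
    ((congrArg vpt hvertex).trans (pt_corner false (c.cube i')).symm)

theorem Represents.unique {w : c.Coord → I} {q q' : X.Realization} (h : c.Represents w q)
    (h' : c.Represents w q') : q = q' := by
  obtain ⟨i, h1, h0, rfl⟩ := h
  obtain ⟨i', h1', h0', rfl⟩ := h'
  wlog hlt : i < i' generalizing i i'
  · rcases (not_lt.1 hlt).eq_or_lt with rfl | hgt
    · rfl
    · exact (this i' h1' h0' i h1 h0 hgt).symm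
  have hadj : i.succ = i'.castSucc := by
    refine le_antisymm hlt (not_lt.1 fun hgap => ?_)
    have hj : (i : ℕ) + 1 < i' := hgap
    let j : Fin c.n := ⟨i + 1, hj.trans i'.2⟩
    let a : c.Coord := ⟨j, 0, c.dim_pos j⟩
    exact zero_ne_one ((h0 a (Nat.lt_succ_self i)).symm.trans (h1' a hj))
  rw [show (fun j => w ⟨i, j⟩) = 1 from funext fun j => h1' ⟨i, j⟩ hlt,
    show (fun j => w ⟨i', j⟩) = 0 from funext fun j => h0 ⟨i', j⟩ hlt, pt_one_eq_pt_zero hadj]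

theorem isClosed_represents :
    IsClosed {r : (c.Coord → I) × X.Realization | c.Represents r.1 r.2} := by
  have hcoord : ∀ a, Continuous fun r : (c.Coord → I) × X.Realization => r.1 a :=
    fun a => (continuous_apply a).comp continuous_fst
  have hclosed : ∀ i, IsClosed {r : (c.Coord → I) × X.Realization |
      (∀ a : c.Coord, a.1 < i → r.1 a = 1) ∧ (∀ a : c.Coord, i < a.1 → r.1 a = 0) ∧
        r.2 = pt (c.cube i) (fun j => r.1 ⟨i, j⟩)} := by
    intro i
    simp only [ofPred_and, ofPred_forall]
    exact (isClosed_iInter fun a => isClosed_iInter fun _ =>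
      isClosed_eq (hcoord a) continuous_const).inter ((isClosed_iInter fun a =>
        isClosed_iInter fun _ => isClosed_eq (hcoord a) continuous_const).inter
          (isClosed_eq continuous_snd ((continuous_pt _).comp (continuous_pi fun j => hcoord _))))
  simpa only [Represents, ofPred_exists] using isClosed_iUnion_of_finite hclosed

theorem isClosed_isLift :
    IsClosed {r : (I → c.Coord → I) × C(I, X.Realization) | c.IsLift r.1 r.2} := by
  have hset : {r : (I → c.Coord → I) × C(I, X.Realization) | c.IsLift r.1 r.2} =
      {r | Monotone r.1} ∩ ({r | r.1 0 = 0} ∩ ({r | r.1 1 = 1} ∩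
        ⋂ s, {r | c.Represents (r.1 s) (r.2 s)})) := by
    ext r
    simp only [mem_inter_iff, mem_iInter, mem_ofPred_eq]
    exact ⟨fun h => ⟨h.1, h.2, h.3, h.4⟩, fun h => ⟨h.1, h.2.1, h.2.2.1, h.2.2.2⟩⟩
  have happly : ∀ s, Continuous fun r : (I → c.Coord → I) × C(I, X.Realization) => r.1 s :=
    fun s => (continuous_apply s).comp continuous_fst
  rw [hset]
  refine (isClosed_monotone.preimage continuous_fst).inter
    ((isClosed_eq (happly 0) continuous_const).inter
      ((isClosed_eq (happly 1) continuous_const).inter (isClosed_iInter fun s => ?_)))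
  exact isClosed_represents.preimage
    ((happly s).prodMk ((continuous_eval_const s).comp continuous_snd))

theorem exists_continuous_isLift {p : C(I, X.Realization)} (h : p ∈ c.tamePathsIn) :
    ∃ B, Continuous B ∧ c.IsLift B p := by
  obtain ⟨t, ht, h⟩ := h
  have hle : ∀ i : Fin c.n, t i.castSucc ≤ t i.succ := fun i => ht.1 (Fin.castSucc_le_succ i)
  choose β hβ hp hβ0 hβ1 using h
  let B : I → c.Coord → I := fun s a => β a.1 (projIcc _ _ (hle a.1) s : Icc _ _) a.2
  have hB0 : ∀ a s, s ≤ t a.1.castSucc → B s a = 0 := fun a s hs => by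
    simp only [B, projIcc_of_le_left (hle a.1) hs, hβ0, Pi.zero_apply]
  have hB1 : ∀ a s, t a.1.succ ≤ s → B s a = 1 := fun a s hs => by
    simp only [B, projIcc_of_right_le (hle a.1) hs, hβ1, Pi.one_apply]
  refine ⟨B, continuous_pi fun a => ?_, fun s s' hss' a => ?_, funext fun a => hB0 a 0 nonneg',
    funext fun a => hB1 a 1 le_one', fun s => ?_⟩
  · exact (continuousOn_pi.1 (hβ a.1).1 a.2).comp_continuous
      (continuous_subtype_val.comp continuous_projIcc) fun s => Subtype.coe_prop _
  · exact (hβ a.1).2 (Subtype.coe_prop _) (Subtype.coe_prop _) (monotone_projIcc _ hss') a.2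
  · obtain ⟨i, hi⟩ := ht.exists_mem_Icc s
    refine ⟨i, fun a ha => hB1 a s ((ht.1 ?_).trans hi.1),
      fun a ha => hB0 a s (hi.2.trans (ht.1 ?_)), ?_⟩
    · exact Fin.succ_le_castSucc_iff.2 ha
    · exact Fin.succ_le_castSucc_iff.2 ha
    · simp only [B, projIcc_of_mem (hle i) hi]
      exact hp i s hi

theorem exists_isLift_of_mem_closure {p : C(I, X.Realization)} (h : p ∈ closure c.tamePathsIn) :
    ∃ B, c.IsLift B p := by
  have hclosed := isClosedMap_snd_of_compactSpace _ (isClosed_isLift (c := c))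
  obtain ⟨⟨B, p⟩, hB, rfl⟩ := closure_minimal (fun q hq => by
    obtain ⟨B, -, hB⟩ := exists_continuous_isLift hq
    exact ⟨(B, q), hB, rfl⟩) hclosed h
  exact ⟨B, hB⟩

/-- The `k`-th vertex of the wedge of the cubes of the chain. -/
def wedgeVertex (c : CubeChain X x y) (k : Fin (c.n + 1)) (a : c.Coord) : I :=
  endpt (decide (a.1.castSucc < k))

theorem wedgeVertex_of_lt {k : Fin (c.n + 1)} {a : c.Coord} (h : a.1.castSucc < k) :
    c.wedgeVertex k a = 1 := by
  simp [wedgeVertex, endpt, h]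

theorem wedgeVertex_of_le {k : Fin (c.n + 1)} {a : c.Coord} (h : k ≤ a.1.castSucc) :
    c.wedgeVertex k a = 0 := by
  simp [wedgeVertex, endpt, h.not_gt]

theorem wedgeVertex_zero : c.wedgeVertex 0 = 0 :=
  funext fun _ => wedgeVertex_of_le (Fin.zero_le _)

theorem wedgeVertex_last : c.wedgeVertex (Fin.last c.n) = 1 :=
  funext fun a => wedgeVertex_of_lt (Fin.castSucc_lt_last a.1)

theorem wedgeVertex_strictMono : StrictMono c.wedgeVertex := by
  refine Fin.strictMono_iff_lt_succ.2 fun i => Pi.lt_def.2 ⟨fun a => ?_, ⟨i, 0, c.dim_pos i⟩, ?_⟩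
  · rcases lt_or_ge a.1.castSucc i.succ with h | h
    · exact le_one'.trans_eq (wedgeVertex_of_lt h).symm
    · exact (wedgeVertex_of_le ((Fin.castSucc_le_succ i).trans h)).trans_le nonneg'
  · exact (wedgeVertex_of_le le_rfl).trans_lt
      (zero_lt_one.trans_eq (wedgeVertex_of_lt Fin.castSucc_lt_succ).symm)

theorem Represents.le_or_wedgeVertex_le {w : c.Coord → I} {q : X.Realization}
    (h : c.Represents w q) (k : Fin (c.n + 1)) : w ≤ c.wedgeVertex k ∨ c.wedgeVertex k ≤ w := by
  obtain ⟨i, h1, h0, -⟩ := h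
  rcases lt_or_ge i.castSucc k with hik | hik
  · refine Or.inl fun a => ?_
    rcases lt_or_ge i a.1 with ha | ha
    · exact (h0 a ha).trans_le nonneg'
    · exact le_one'.trans_eq (wedgeVertex_of_lt (lt_of_le_of_lt (by simpa using ha) hik)).symm
  · refine Or.inr fun a => ?_
    rcases lt_or_ge a.1 i with ha | ha
    · exact le_one'.trans_eq (h1 a ha).symm
    · exact (wedgeVertex_of_le (hik.trans (by simpa using ha))).trans_le nonneg'

theorem represents_of_wedgeVertex_le {w : c.Coord → I} {i : Fin c.n}
    (h : c.wedgeVertex i.castSucc ≤ w) (h' : w ≤ c.wedgeVertex i.succ) :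
    c.Represents w (pt (c.cube i) fun j => w ⟨i, j⟩) :=
  ⟨i, fun a ha => le_antisymm le_one' ((wedgeVertex_of_lt (by simpa using ha)).symm.trans_le (h a)),
    fun a ha => le_antisymm ((h' a).trans_eq (wedgeVertex_of_le (Fin.succ_le_castSucc_iff.2 ha)))
      nonneg', rfl⟩

variable {p : C(I, X.Realization)} {B : I → c.Coord → I}

theorem IsLift.exists_eq_wedgeVertex (hB : c.IsLift B p) (hc : Continuous B)
    (k : Fin (c.n + 1)) : ∃ s, B s = c.wedgeVertex k := by
  -- Points of the wedge are comparable with its vertices, so that it suffices to match the sums.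
  let f : (c.Coord → I) → ℝ := fun w => ∑ a, (w a : ℝ)
  have hf : Monotone f := fun v w hvw => Finset.sum_le_sum fun a _ => hvw a
  have heq : ∀ {v w : c.Coord → I}, v ≤ w → f v = f w → v = w := fun hvw h =>
    funext fun a => Subtype.ext ((Finset.sum_eq_sum_iff_of_le fun a _ =>
      Subtype.coe_le_coe.2 (hvw a)).1 h a (Finset.mem_univ a))
  have hcont : Continuous fun s => f (B s) := continuous_finsetSum _ fun a _ =>
    continuous_subtype_val.comp ((continuous_apply a).comp hc)
  obtain ⟨s, hs⟩ := mem_range_of_exists_le_of_exists_ge hcont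
    ⟨0, hf (hB.zero.trans_le fun _ => nonneg')⟩
    ⟨1, hf (show c.wedgeVertex k ≤ B 1 from hB.one ▸ fun _ => le_one')⟩
  rcases (hB.represents s).le_or_wedgeVertex_le k with hle | hge
  · exact ⟨s, heq hle hs⟩
  · exact ⟨s, (heq hge hs.symm).symm⟩

theorem IsLift.exists_isSubdivision (hB : c.IsLift B p) (hc : Continuous B) :
    ∃ t : Fin (c.n + 1) → I, IsSubdivision t ∧ ∀ k, B (t k) = c.wedgeVertex k := by
  have hex : ∀ k : Fin (c.n + 1), ∃ s, B s = c.wedgeVertex k ∧ (k = 0 → s = 0) ∧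
      (k = Fin.last c.n → s = 1) := by
    intro k
    have hne : (0 : Fin (c.n + 1)) ≠ Fin.last c.n := Fin.ne_of_val_ne c.n_pos.ne
    rcases eq_or_ne k 0 with rfl | h0
    · exact ⟨0, hB.zero.trans wedgeVertex_zero.symm, fun _ => rfl, fun h => absurd h hne⟩
    rcases eq_or_ne k (Fin.last c.n) with rfl | h1
    · exact ⟨1, hB.one.trans wedgeVertex_last.symm, fun h => absurd h.symm hne, fun _ => rfl⟩
    obtain ⟨s, hs⟩ := hB.exists_eq_wedgeVertex hc k
    exact ⟨s, hs, fun h => absurd h h0, fun h => absurd h h1⟩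
  choose t ht h0 h1 using hex
  refine ⟨t, ⟨StrictMono.monotone fun k k' hk => hB.monotone.reflect_lt ?_, h0 0 rfl, h1 _ rfl⟩, ht⟩
  rw [ht, ht]
  exact wedgeVertex_strictMono hk

theorem IsLift.mem_tamePathsIn (hB : c.IsLift B p) (hc : Continuous B) : p ∈ c.tamePathsIn := by
  obtain ⟨t, ht, hv⟩ := hB.exists_isSubdivision hc
  refine ⟨t, ht, fun i => ⟨fun s j => B s ⟨i, j⟩, ⟨?_, ?_⟩, fun s hs => ?_, ?_, ?_⟩⟩
  · exact (continuous_pi fun j => (continuous_apply (⟨i, j⟩ : c.Coord)).comp hc).continuousOn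
  · exact fun s _ s' _ hss' j => hB.monotone hss' ⟨i, j⟩
  · exact (hB.represents s).unique (represents_of_wedgeVertex_le
      ((hv _).symm.trans_le (hB.monotone hs.1)) ((hB.monotone hs.2).trans_eq (hv _)))
  · exact funext fun j => (congrFun (hv _) _).trans (wedgeVertex_of_le le_rfl)
  · exact funext fun j => (congrFun (hv _) _).trans (wedgeVertex_of_lt Fin.castSucc_lt_succ)

theorem IsLift.numHalves_eq_sum (hB : c.IsLift B p) (s : I) :
    numHalves (p s) = ∑ a, halfIndicator (B s a) :=
  (hB.represents s).coordSum_eq _ _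

theorem IsLift.numHalves_ne_zero (hB : c.IsLift B p) {a : c.Coord} {s : I}
    (h : (B s a : ℝ) = 1 / 2) : numHalves (p s) ≠ 0 := by
  rw [hB.numHalves_eq_sum]
  exact (Finset.sum_pos' (fun _ _ => Nat.zero_le _)
    ⟨a, Finset.mem_univ a, (halfIndicator_of_eq h).symm ▸ zero_lt_one⟩).ne'

theorem IsLift.subsingleton_half (hB : c.IsLift B p) (hp : IsStrict p) (a : c.Coord) :
    {s | (B s a : ℝ) = 1 / 2}.Subsingleton := by
  have hord : OrdConnected {s | (B s a : ℝ) = 1 / 2} := by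
    refine ⟨fun s hs s' hs' τ hτ => le_antisymm ?_ ?_⟩
    · exact (show (B τ a : ℝ) ≤ B s' a from hB.monotone hτ.2 a).trans_eq hs'
    · exact hs.symm.trans_le (show (B s a : ℝ) ≤ B τ a from hB.monotone hτ.1 a)
  have hfin : {s | (B s a : ℝ) = 1 / 2}.Finite :=
    hp.finite_numHalves_ne_zero.subset fun s hs => hB.numHalves_ne_zero hs
  by_contra hsub
  obtain ⟨s, hs, s', hs', hlt⟩ := (not_subsingleton_iff.1 hsub).exists_lt
  exact Icc_infinite hlt (hfin.subset (hord.out hs hs'))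

theorem IsLift.exists_apply_eq_half_of_continuous (hB : c.IsLift B p) (hc : Continuous B)
    (a : c.Coord) : ∃ s, (B s a : ℝ) = 1 / 2 :=
  mem_range_of_exists_le_of_exists_ge
    (continuous_subtype_val.comp ((continuous_apply a).comp hc))
    ⟨0, by norm_num [hB.zero]⟩ ⟨1, by norm_num [hB.one]⟩

theorem IsLift.exists_apply_eq_half (hB : c.IsLift B p) (hp : IsStrict p) {t : ℝ≥0}
    (ht : pathFlow X t p ∈ c.tamePathsIn) (a : c.Coord) : ∃ s, (B s a : ℝ) = 1 / 2 := by
  obtain ⟨B', hc, hB'⟩ := exists_continuous_isLift ht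
  have hnum : ∀ s, numHalves (pathFlow X t p s) = numHalves (p s) := fun s =>
    numHalves_stretchFlow t (p s)
  by_contra! hmiss
  let T := hp.finite_numHalves_ne_zero.toFinset
  have hsum : ∑ b, ∑ s ∈ T, halfIndicator (B s b) = ∑ b, ∑ s ∈ T, halfIndicator (B' s b) := by
    rw [Finset.sum_comm, Finset.sum_comm (s := Finset.univ)]
    exact Finset.sum_congr rfl fun s _ => by
      rw [← hB.numHalves_eq_sum, ← hB'.numHalves_eq_sum, hnum]
  have hlow : ∀ b, 1 ≤ ∑ s ∈ T, halfIndicator (B' s b) := by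
    intro b
    obtain ⟨s, hs⟩ := hB'.exists_apply_eq_half_of_continuous hc b
    have hsT : s ∈ T := (Finite.mem_toFinset _).2 (hnum s ▸ hB'.numHalves_ne_zero hs :)
    exact (halfIndicator_of_eq hs).symm.trans_le (Finset.single_le_sum_of_canonicallyOrdered
      (f := fun s => halfIndicator (B' s b)) hsT)
  have hup : ∀ b, ∑ s ∈ T, halfIndicator (B s b) ≤ 1 := by
    intro b
    simp only [halfIndicator, indicator, mem_ofPred_eq, Pi.one_apply, Finset.sum_boole, Nat.cast_id]
    exact Finset.card_le_one.2 fun s hs s' hs' =>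
      hB.subsingleton_half hp b (Finset.mem_filter.1 hs).2 (Finset.mem_filter.1 hs').2
  have hzero : ∑ s ∈ T, halfIndicator (B s a) = 0 :=
    Finset.sum_eq_zero fun s _ => halfIndicator_of_ne (hmiss s)
  exact (Finset.sum_lt_sum (fun b _ => (hup b).trans (hlow b))
    ⟨a, Finset.mem_univ a, hzero.trans_lt (hlow a)⟩).ne hsum

theorem IsLift.half_lt_apply (hB : c.IsLift B p) (hp : IsStrict p) {a : c.Coord} {s τ : I}
    (hτ : (B τ a : ℝ) = 1 / 2) (h : τ < s) : 1 / 2 < (B s a : ℝ) :=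
  lt_of_le_of_ne (hτ.symm.trans_le (hB.monotone h.le a)) fun hs =>
    h.ne (hB.subsingleton_half hp a hτ hs.symm)

theorem IsLift.apply_lt_half (hB : c.IsLift B p) (hp : IsStrict p) {a : c.Coord} {s τ : I}
    (hτ : (B τ a : ℝ) = 1 / 2) (h : s < τ) : (B s a : ℝ) < 1 / 2 :=
  lt_of_le_of_ne (le_of_le_of_eq (hB.monotone h.le a) hτ) fun hs =>
    h.ne (hB.subsingleton_half hp a hs hτ)

section Limits

variable {s : I} {w : c.Coord → I} {g : Filter I} [g.NeBot]

theorem IsLift.eq_of_tendsto_of_le (hB : c.IsLift B p) (hp : IsStrict p)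
    (hhalf : ∀ a, ∃ τ, (B τ a : ℝ) = 1 / 2) (hrep : c.Represents w (p s)) (hg : g ≤ 𝓝 s)
    (hw : Tendsto B g (𝓝 w)) (hle : ∀ᶠ τ in g, τ ≤ s) : w = B s := by
  have hwa : ∀ a, Tendsto (fun τ => B τ a) g (𝓝 (w a)) := tendsto_pi_nhds.1 hw
  refine hrep.eq_of_le_of_mem (hB.represents s)
    (fun a => le_of_tendsto (hwa a) (hle.mono fun τ hτ => hB.monotone hτ a))
    (S := {x | 1 / 2 < (x : ℝ)}) (by norm_num) (by norm_num) fun a ha => ?_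
  obtain ⟨τ, hτ⟩ := hhalf a
  have hτs : τ < s := not_le.1 fun h =>
    not_lt.2 ((Subtype.coe_le_coe.2 (hB.monotone h a)).trans_eq hτ) ha
  obtain ⟨s', hτs', hs's⟩ := exists_between hτs
  have hge : B s' a ≤ w a := ge_of_tendsto (hwa a)
    (((lt_mem_nhds hs's).filter_mono hg).mono fun τ' hτ' => hB.monotone hτ'.le a)
  exact (hB.half_lt_apply hp hτ hτs').trans_le (Subtype.coe_le_coe.2 hge)

theorem IsLift.eq_of_tendsto_of_ge (hB : c.IsLift B p) (hp : IsStrict p)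
    (hhalf : ∀ a, ∃ τ, (B τ a : ℝ) = 1 / 2) (hrep : c.Represents w (p s)) (hg : g ≤ 𝓝 s)
    (hw : Tendsto B g (𝓝 w)) (hge : ∀ᶠ τ in g, s ≤ τ) : B s = w := by
  have hwa : ∀ a, Tendsto (fun τ => B τ a) g (𝓝 (w a)) := tendsto_pi_nhds.1 hw
  refine (hB.represents s).eq_of_le_of_mem hrep
    (fun a => ge_of_tendsto (hwa a) (hge.mono fun τ hτ => hB.monotone hτ a))
    (S := {x | 1 / 2 ≤ (x : ℝ)}) (by norm_num) (by norm_num) fun a ha => ?_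
  obtain ⟨τ, hτ⟩ := hhalf a
  by_contra hlt
  have hsτ : s < τ := not_le.1 fun h =>
    hlt (hτ.symm.trans_le (Subtype.coe_le_coe.2 (hB.monotone h a)))
  obtain ⟨s', hss', hs'τ⟩ := exists_between hsτ
  have hle : w a ≤ B s' a := le_of_tendsto (hwa a)
    (((gt_mem_nhds hss').filter_mono hg).mono fun τ' hτ' => hB.monotone hτ'.le a)
  exact not_lt.2 (ha.trans (Subtype.coe_le_coe.2 hle)) (hB.apply_lt_half hp hτ hs'τ)

end Limits

theorem IsLift.continuous (hB : c.IsLift B p) (hp : IsStrict p)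
    (hhalf : ∀ a, ∃ τ, (B τ a : ℝ) = 1 / 2) : Continuous B := by
  refine continuous_iff_ultrafilter.2 fun s g hg => ?_
  obtain ⟨w, hw⟩ : ∃ w, Tendsto B g (𝓝 w) := ⟨_, (g.map B).le_nhds_lim⟩
  have hrep : c.Represents w (p s) := isClosed_represents.mem_of_tendsto
    (hw.prodMk_nhds ((p.continuous.tendsto s).mono_left hg)) (.of_forall hB.represents)
  rcases Ultrafilter.eventually_or.1 (.of_forall fun τ => le_total τ s : ∀ᶠ τ in g, τ ≤ s ∨ s ≤ τ)
    with hle | hge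
  · exact hB.eq_of_tendsto_of_le hp hhalf hrep hg hw hle ▸ hw
  · exact hB.eq_of_tendsto_of_ge hp hhalf hrep hg hw hge ▸ hw

theorem mem_tamePathsIn_of_mem_closure (hp : p ∈ closure c.tamePathsIn) (hs : IsStrict p) {t : ℝ≥0}
    (ht : pathFlow X t p ∈ c.tamePathsIn) : p ∈ c.tamePathsIn := by
  obtain ⟨B, hB⟩ := exists_isLift_of_mem_closure hp
  exact hB.mem_tamePathsIn (hB.continuous hs (hB.exists_apply_eq_half hs ht))

variable (c) {S : Set C(I, X.Realization)}

theorem isInvariant_strictTameIn : IsInvariant (pathFlow X) c.strictTameIn := fun t _ h =>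
  ⟨isInvariant_tamePathsIn t h.1, isInvariant_strictPaths x y t h.2⟩

theorem isInvariant_strictInCollar : IsInvariant (pathFlow X) c.strictInCollar := fun t _ h =>
  ⟨isInvariant_pathsInCollar t h.1, isInvariant_strictPaths x y t h.2⟩

theorem isInvariant_strictTameInCollar :
    IsInvariant (pathFlow X) c.strictTameInCollar := fun t _ h =>
  ⟨isInvariant_pathsInCollar t h.1, isInvariant_strictTamePaths x y t h.2⟩

theorem isDeformationRetract_strictTameIn (hS : IsInvariant (pathFlow X) S)
    (hle : c.strictTameIn ⊆ S) (hge : S ⊆ c.strictInCollar) :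
    IsDeformationRetract c.strictTameIn S := by
  refine isDeformationRetract_of_flow c.isInvariant_strictTameIn hS hle ?_ ?_ ?_
  · rintro p ⟨hcl, hp⟩
    obtain ⟨t, ht⟩ := exists_pathFlow_mem_tamePathsIn (hge hp).1
    exact ⟨mem_tamePathsIn_of_mem_closure (closure_mono inter_subset_left hcl) (hge hp).2.2.2 ht,
      (hge hp).2⟩
  · intro p hp t ht
    filter_upwards [nhdsWithin_le_nhds (eventually_pathFlow_mem_tamePathsIn hp.1 ht),
      self_mem_nhdsWithin] with q hq hqS
    have hstrict := (hge hqS).2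
    exact ⟨hq hstrict.2.2.isDPath, isInvariant_strictPaths x y t hstrict⟩
  · intro p hp
    obtain ⟨t, ht⟩ := exists_pathFlow_mem_tamePathsIn (hge hp).1
    exact ⟨t, ht, isInvariant_strictPaths x y t (hge hp).2⟩

end CubeChain

end PrecubicalSet

theorem mainTheorem6 (X : PrecubicalSet.{u}) (x y : X.cube 0)
    (c : PrecubicalSet.CubeChain X x y) :
    IsDeformationRetract c.strictTameIn c.strictInCollar ∧
      IsDeformationRetract c.strictTameIn c.strictTameInCollar := by
  have htame : c.strictTameIn ⊆ c.strictTameInCollar := c.strictTameIn_subset_strictTameInCollar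
  have hcollar : c.strictTameInCollar ⊆ c.strictInCollar :=
    c.strictTameInCollar_subset_strictInCollar
  exact ⟨c.isDeformationRetract_strictTameIn c.isInvariant_strictInCollar (htame.trans hcollar)
      subset_rfl,
    c.isDeformationRetract_strictTameIn c.isInvariant_strictTameInCollar htame hcollar⟩
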